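/- Let $N\ge 2$, $0<a<1$ and $1<p<\infty$. Write points of $\mathbb{R}^N$ as $x=(x',x_N)\in\mathbb{R}^{N-1}\times\mathbb{R}$. For a function $\eta:\mathbb{R}^{N-1}\to\mathbb{R}$ let $|\eta|_{0,1}=\sup_{x'\ne y'}|\eta(x')-\eta(y')|/|x'-y'|$. For $\sigma:\mathbb{R}^{N-1}\to(0,\infty)$ and a measurable $f:\mathbb{R}^{N-1}\to\mathbb{R}$ define the screened seminorm $$|f|_{(\sigma)}:=\left(\int_{\mathbb{R}^{N-1}}\int_{B'(0,\sigma(x'))}\frac{|f(x'+h')-f(x')|^p}{|h'|^{p+N-2}}\,dh'\,dx'\right)^{1/p},$$ where $B'(0,r)$ is the open ball of radius $r$ in $\mathbb{R}^{N-1}$ (this is the screened homogeneous fractional Sobolev seminorm of order $s=1-1/p$). For an open set $\Omega\subseteq\mathbb{R}^N$ let $\dot W^{1,p}(\Omega)$ be the space of all $u\in L^1_{\mathrm{loc}}(\Omega)$ whose weak gradient belongs to $L^p(\Omega)$. There is a constant $c=c(a,N,p)>0$ with the following property. Let $\eta^\pm:\mathbb{R}^{N-1}\to\mathbb{R}$ be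 Lipschitz continuous with $\eta^-<\eta^+$ everywhere, put $L:=|\eta^-|_{0,1}+|\eta^+|_{0,1}$ and $$\Omega:=\{x\in\mathbb{R}^N : \eta^-(x')<x_N<\eta^+(x')\},$$ and let $X$ be the vector space of all pairs $(f^-,f^+)$ of functions in $L^p_{\mathrm{loc}}(\mathbb{R}^{N-1})$ such that $$\int_{\mathbb{R}^{N-1}}\frac{|f^+(x')-f^-(x')|^p}{(\eta^+(x')-\eta^-(x'))^{p-1}}\,dx'<\infty,\qquad |f^-|_{(a(\eta^+-\eta^-))}<\infty,\qquad |f^+|_{(a(\eta^+-\eta^-))}<\infty.$$ Then there is a linear map $X\to\dot W^{1,p}(\Omega)$, $(f^-,f^+)\mapsto u$, such that for every $(f^-,f^+)\in X$ the trace of $u$ on $\partial\Omega$ satisfies $\operatorname{Tr}(u)(x',\eta^\pm(x'))=f^\pm(x')$ for almost every $x'\in\mathbb{R}^{N-1}$, and $$\int_\Omega|\nabla u|^p\,dx\le c(1+L)^p\int_{\mathbb{R}^{N-1}}\frac{|f^+(x')-f^-(x')|^p}{(\eta^+(x')-\eta^-(x'))^{p-1}}\,dx'+c(1+L)^p|f^-|^p_{(a(\eta^+-\eta^-))}+c(1+L)^p|f^+|^p_{(a(\eta^+-\eta^-))}.$$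 Here the trace $\operatorname{Tr}(u)\in L^p_{\mathrm{loc}}(\partial\Omega)$ is the ($\mathcal{H}^{N-1}$-almost everywhere unique) function with $$\int_\Omega u\,\partial_i\psi\,dx=-\int_\Omega\psi\,\partial_iu\,dx+\int_{\partial\Omega}\psi\operatorname{Tr}(u)\,\nu_i\,d\mathcal{H}^{N-1}$$ for all $\psi\in C^1_c(\mathbb{R}^N)$ and $i=1,\dots,N$, where $\nu$ is the outward unit normal. -/

import Mathlib

open MeasureTheory Set
open scoped ENNReal NNReal

noncomputable section

/-- The horizontal space `ℝⁿ`, where `n = N - 1`. Points of `ℝᴺ` are pairs `(x', x_N) ∈ ℝⁿ × ℝ`. -/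
abbrev Horiz (n : ℕ) : Type := EuclideanSpace ℝ (Fin n)

/-- Vectors of `ℝᴺ = ℝⁿ × ℝ` with the Euclidean norm and inner product; gradients live here. -/
abbrev EVec (n : ℕ) : Type := WithLp 2 (Horiz n × ℝ)

/-- The Lipschitz seminorm `sup { |η x - η y| / |x - y| : x ≠ y }`, with values in `[0, ∞]`;
`η` is Lipschitz exactly if it is finite. (Pairs `x = y` contribute `0 / 0 = 0`.) -/
def lipSeminorm {n : ℕ} (η : Horiz n → ℝ) : ℝ≥0∞ :=
  ⨆ (x : Horiz n) (y : Horiz n), edist (η x) (η y) / edist x y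

/-- The strip-like domain between the graphs of `ηm` (below) and `ηp` (above). -/
def stripDomain {n : ℕ} (ηm ηp : Horiz n → ℝ) : Set (Horiz n × ℝ) :=
  {x | ηm x.1 < x.2 ∧ x.2 < ηp x.1}

/-- `G` is the weak gradient of `u` on the open set `Ω`: both are locally integrable on `Ω`, and
`∫_Ω u ∂_v φ = - ∫_Ω φ (v · G)` for all test functions `φ ∈ C_c^∞(Ω)` and all directions `v`. -/
def IsWeakGradient {n : ℕ} (Ω : Set (Horiz n × ℝ)) (u : Horiz n × ℝ → ℝ)
    (G : Horiz n × ℝ → EVec n) : Prop :=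
  LocallyIntegrableOn u Ω ∧ LocallyIntegrableOn G Ω ∧
    ∀ φ : Horiz n × ℝ → ℝ, ContDiff ℝ (⊤ : ℕ∞) φ → HasCompactSupport φ → tsupport φ ⊆ Ω →
      ∀ v : Horiz n × ℝ,
        ∫ x in Ω, u x * fderiv ℝ φ x v = - ∫ x in Ω, φ x * inner ℝ (WithLp.toLp 2 v) (G x)

/-- `∫_Ω |G|^p`, with the Euclidean norm of `G`. -/
def gradEnergy {n : ℕ} (p : ℝ) (Ω : Set (Horiz n × ℝ)) (G : Horiz n × ℝ → EVec n) : ℝ≥0∞ :=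
  ∫⁻ x in Ω, ‖G x‖ₑ ^ p

/-- Membership in `L^p_loc(ℝⁿ)`. -/
def MemLpLoc {n : ℕ} (p : ℝ) (f : Horiz n → ℝ) : Prop :=
  ∀ K : Set (Horiz n), IsCompact K → MemLp f (ENNReal.ofReal p) (volume.restrict K)

/-- The `p`-th power of the screened seminorm: the double integral of
`|f(x + h) - f(x)|^p / |h|^(s p + n)` over `x ∈ ℝⁿ` and `h ∈ B(0, σ(x))`. -/
def screenedEnergy {n : ℕ} (s p : ℝ) (σ : Horiz n → ℝ) (f : Horiz n → ℝ) : ℝ≥0∞ :=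
  ∫⁻ x, ∫⁻ h in Metric.ball (0 : Horiz n) (σ x),
    ‖f (x + h) - f x‖ₑ ^ p / ‖h‖ₑ ^ (s * p + n)

/-- The screened homogeneous fractional Sobolev seminorm on `ℝⁿ` with screening function `σ`. -/
def screenedSeminorm {n : ℕ} (s p : ℝ) (σ : Horiz n → ℝ) (f : Horiz n → ℝ) : ℝ≥0∞ :=
  screenedEnergy s p σ f ^ (1 / p)

/-- The weighted difference `∫ |fp - fm|^p / (ηp - ηm)^(p - 1)`. -/
def weightedDiff {n : ℕ} (p : ℝ) (ηm ηp fm fp : Horiz n → ℝ) : ℝ≥0∞ :=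
  ∫⁻ x, ‖fp x - fm x‖ₑ ^ p / ENNReal.ofReal ((ηp x - ηm x) ^ (p - 1))

/-- `u`, with weak gradient `G` on the strip-like domain `Ω`, has the boundary trace
`Tr u (x', ηm x') = fm x'`, `Tr u (x', ηp x') = fp x'`. The trace is the `L^p_loc(∂Ω)` function
that makes the integration by parts formula
`∫_Ω u ∂_v ψ = - ∫_Ω ψ (v · G) + ∫_{∂Ω} ψ (Tr u) (v · ν) dℋ^{N-1}`
true for all `ψ ∈ C_c^1(ℝᴺ)`, which determines it almost everywhere.
In graph coordinates, the vector measure `ν dℋ^{N-1}` (`ν` the outward unit normal) is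
`(-∇ηp, 1) dx'` on the upper graph and `(∇ηm, -1) dx'` on the lower graph. -/
def HasTrace {n : ℕ} (p : ℝ) (ηm ηp : Horiz n → ℝ) (u : Horiz n × ℝ → ℝ)
    (G : Horiz n × ℝ → EVec n) (fm fp : Horiz n → ℝ) : Prop :=
  MemLpLoc p fm ∧ MemLpLoc p fp ∧
  (∀ K : Set (Horiz n × ℝ), IsCompact K → IntegrableOn u (stripDomain ηm ηp ∩ K)) ∧
  (∀ K : Set (Horiz n × ℝ), IsCompact K → IntegrableOn G (stripDomain ηm ηp ∩ K)) ∧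
  ∀ ψ : Horiz n × ℝ → ℝ, ContDiff ℝ 1 ψ → HasCompactSupport ψ → ∀ v : Horiz n × ℝ,
    ∫ x in stripDomain ηm ηp, u x * fderiv ℝ ψ x v =
      - (∫ x in stripDomain ηm ηp, ψ x * inner ℝ (WithLp.toLp 2 v) (G x))
      + (∫ x, ψ (x, ηp x) * fp x * (v.2 - fderiv ℝ ηp x v.1))
      - (∫ x, ψ (x, ηm x) * fm x * (v.2 - fderiv ℝ ηm x v.1))

/-! ### The homogeneous Sobolev space as a vector space -/

theorem integrableOn_mul_of_tsupport_subset {n : ℕ} {Ω : Set (Horiz n × ℝ)}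
    {u ψ : Horiz n × ℝ → ℝ} (hu : LocallyIntegrableOn u Ω) (hψ : Continuous ψ)
    (hc : HasCompactSupport ψ) (hs : tsupport ψ ⊆ Ω) :
    IntegrableOn (fun x => u x * ψ x) Ω := by
  have h1 : IntegrableOn u (tsupport ψ) := hu.integrableOn_compact_subset hs hc
  have h2 : IntegrableOn (fun x => u x * ψ x) (tsupport ψ) :=
    h1.mul_continuousOn hψ.continuousOn hc
  refine ((integrableOn_iff_integrable_of_support_subset ?_).1 h2).integrableOn
  intro x hx
  refine subset_tsupport ψ ?_
  intro h0
  exact hx (by simp [h0])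

theorem IsWeakGradient.linearComb {n : ℕ} {Ω : Set (Horiz n × ℝ)} {u w : Horiz n × ℝ → ℝ}
    {G H : Horiz n × ℝ → EVec n} (hu : IsWeakGradient Ω u G) (hw : IsWeakGradient Ω w H)
    (c : ℝ) : IsWeakGradient Ω (u + c • w) (G + c • H) := by
  refine ⟨hu.1.add (hw.1.smul c), hu.2.1.add (hw.2.1.smul c), ?_⟩
  intro φ hφ hc hs v
  have hd : Continuous fun x => fderiv ℝ φ x v :=
    (hφ.continuous_fderiv (by simp)).clm_apply continuous_const
  have hdc : HasCompactSupport fun x => fderiv ℝ φ x v :=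
    hc.fderiv_apply (𝕜 := ℝ) v
  have hds : tsupport (fun x => fderiv ℝ φ x v) ⊆ Ω :=
    (tsupport_fderiv_apply_subset ℝ v).trans hs
  have key : ∀ K : Horiz n × ℝ → EVec n, LocallyIntegrableOn K Ω →
      IntegrableOn (fun x => φ x * inner ℝ (WithLp.toLp 2 v) (K x)) Ω := by
    intro K hK
    have h1 : LocallyIntegrableOn (fun x => inner ℝ (WithLp.toLp 2 v : EVec n) (K x)) Ω :=
      (innerSL ℝ (WithLp.toLp 2 v : EVec n)).locallyIntegrableOn_comp hK
    have h2 := integrableOn_mul_of_tsupport_subset h1 hφ.continuous hc hs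
    simpa only [mul_comm] using h2
  have e1 := integrableOn_mul_of_tsupport_subset hu.1 hd hdc hds
  have e2 := integrableOn_mul_of_tsupport_subset hw.1 hd hdc hds
  have g1 := key G hu.2.1
  have g2 := key H hw.2.1
  have l1 : (fun x => (u + c • w) x * fderiv ℝ φ x v) =
      fun x => u x * fderiv ℝ φ x v + c * (w x * fderiv ℝ φ x v) := by
    funext x; simp only [Pi.add_apply, Pi.smul_apply, smul_eq_mul]; ring
  have l2 : (fun x => φ x * inner ℝ (WithLp.toLp 2 v : EVec n) ((G + c • H) x)) =
      fun x => φ x * inner ℝ (WithLp.toLp 2 v : EVec n) (G x) +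
        c * (φ x * inner ℝ (WithLp.toLp 2 v : EVec n) (H x)) := by
    funext x; simp only [Pi.add_apply, Pi.smul_apply, inner_add_right, inner_smul_right]; ring
  rw [l1, l2, integral_add e1 (e2.const_mul c), integral_add g1 (g2.const_mul c),
    integral_const_mul, integral_const_mul, hu.2.2 φ hφ hc hs v, hw.2.2 φ hφ hc hs v]
  ring

theorem isWeakGradient_zero {n : ℕ} (Ω : Set (Horiz n × ℝ)) :
    IsWeakGradient Ω (0 : Horiz n × ℝ → ℝ) (0 : Horiz n × ℝ → EVec n) := by
  refine ⟨locallyIntegrableOn_zero, locallyIntegrableOn_zero, ?_⟩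
  intro φ _ _ _ v
  simp

/-- The homogeneous Sobolev space `Ẇ^{1,p}(Ω)`: locally integrable functions on `Ω` whose weak
gradient belongs to `L^p(Ω)`. -/
def homSobolev {n : ℕ} (p : ℝ) (Ω : Set (Horiz n × ℝ)) : Submodule ℝ (Horiz n × ℝ → ℝ) where
  carrier := {u | ∃ G : Horiz n × ℝ → EVec n, IsWeakGradient Ω u G ∧
    MemLp G (ENNReal.ofReal p) (volume.restrict Ω)}
  zero_mem' := ⟨0, isWeakGradient_zero Ω, MemLp.zero⟩
  add_mem' := by
    rintro u w ⟨G, hG, hGp⟩ ⟨H, hH, hHp⟩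
    exact ⟨G + (1 : ℝ) • H, by simpa using hG.linearComb hH 1, hGp.add (hHp.const_smul 1)⟩
  smul_mem' := by
    rintro c u ⟨G, hG, hGp⟩
    exact ⟨0 + c • G, by simpa using (isWeakGradient_zero Ω).linearComb hG c,
      MemLp.zero.add (hGp.const_smul c)⟩

/-! ### The data space as a vector space -/

theorem continuous_of_lipSeminorm_ne_top {n : ℕ} {η : Horiz n → ℝ} (h : lipSeminorm η ≠ ⊤) :
    Continuous η := by
  have hL : LipschitzWith (lipSeminorm η).toNNReal η := by
    intro x y
    rw [ENNReal.coe_toNNReal h]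
    rcases eq_or_ne x y with rfl | hxy
    · simp
    · have h0 : edist x y ≠ 0 := by simpa [edist_eq_zero] using hxy
      rw [← ENNReal.div_le_iff h0 (edist_ne_top x y)]
      exact le_iSup₂ (f := fun x y => edist (η x) (η y) / edist x y) x y
  exact hL.continuous

theorem MemLpLoc.aemeasurable {n : ℕ} {p : ℝ} (hp : 1 < p) {f : Horiz n → ℝ}
    (hf : MemLpLoc p f) : AEMeasurable f := by
  have h : LocallyIntegrable f := by
    rw [locallyIntegrable_iff]
    intro K hK
    have : IsFiniteMeasure (volume.restrict K) := ⟨by simpa using hK.measure_lt_top⟩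
    exact (hf K hK).integrable (by simpa using hp.le)
  exact h.aestronglyMeasurable.aemeasurable

theorem lintegral_rpow_add_div_ne_top {α : Type*} [MeasurableSpace α] {μ : Measure α} {p : ℝ}
    (hp : 1 < p) {F G : α → ℝ} {w : α → ℝ≥0∞} (hF : AEMeasurable F μ) (hw : AEMeasurable w μ)
    (h1 : ∫⁻ x, ‖F x‖ₑ ^ p / w x ∂μ ≠ ⊤) (h2 : ∫⁻ x, ‖G x‖ₑ ^ p / w x ∂μ ≠ ⊤) :
    ∫⁻ x, ‖F x + G x‖ₑ ^ p / w x ∂μ ≠ ⊤ := by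
  have hm : AEMeasurable (fun x => ‖F x‖ₑ ^ p / w x) μ := (hF.enorm.pow_const p).div hw
  have hle : ∫⁻ x, ‖F x + G x‖ₑ ^ p / w x ∂μ ≤
      ∫⁻ x, (2 : ℝ≥0∞) ^ (p - 1) * (‖F x‖ₑ ^ p / w x + ‖G x‖ₑ ^ p / w x) ∂μ := by
    refine lintegral_mono fun x => ?_
    have : ‖F x + G x‖ₑ ^ p ≤ (2 : ℝ≥0∞) ^ (p - 1) * (‖F x‖ₑ ^ p + ‖G x‖ₑ ^ p) :=
      (ENNReal.rpow_le_rpow (enorm_add_le _ _) (by linarith)).trans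
        (ENNReal.rpow_add_le_mul_rpow_add_rpow _ _ hp.le)
    calc ‖F x + G x‖ₑ ^ p / w x ≤ (2 : ℝ≥0∞) ^ (p - 1) * (‖F x‖ₑ ^ p + ‖G x‖ₑ ^ p) / w x := by
          gcongr
      _ = _ := by rw [mul_div_assoc, ENNReal.add_div]
  refine ne_top_of_le_ne_top ?_ hle
  have h2' : (2 : ℝ≥0∞) ^ (p - 1) ≠ ⊤ := by
    simp [ENNReal.rpow_eq_top_iff]
  rw [lintegral_const_mul' _ _ h2', lintegral_add_left' hm]
  exact ENNReal.mul_ne_top h2' (ENNReal.add_ne_top.2 ⟨h1, h2⟩)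

theorem lintegral_rpow_smul_div_ne_top {α : Type*} [MeasurableSpace α] {μ : Measure α} {p : ℝ}
    (hp : 1 < p) {F : α → ℝ} {w : α → ℝ≥0∞} (c : ℝ)
    (h1 : ∫⁻ x, ‖F x‖ₑ ^ p / w x ∂μ ≠ ⊤) :
    ∫⁻ x, ‖c * F x‖ₑ ^ p / w x ∂μ ≠ ⊤ := by
  have hc : ‖c‖ₑ ^ p ≠ ⊤ := ENNReal.rpow_ne_top_of_nonneg (by linarith) enorm_ne_top
  have : ∀ x, ‖c * F x‖ₑ ^ p / w x = ‖c‖ₑ ^ p * (‖F x‖ₑ ^ p / w x) := by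
    intro x
    rw [enorm_mul, ENNReal.mul_rpow_of_nonneg _ _ (by linarith), mul_div_assoc]
  simp only [this]
  rw [lintegral_const_mul' _ _ hc]
  exact ENNReal.mul_ne_top hc h1

theorem aemeasurable_increment {n : ℕ} {f : Horiz n → ℝ} (hf : AEMeasurable f) :
    AEMeasurable (fun z : Horiz n × Horiz n => f (z.1 + z.2) - f z.1)
      (volume.prod volume) := by
  have h1 : Measure.QuasiMeasurePreserving (fun z : Horiz n × Horiz n => z.1 + z.2)
      (volume.prod volume) volume :=
    Measure.quasiMeasurePreserving_snd.comp
      (measurePreserving_prod_add volume volume).quasiMeasurePreserving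
  exact (hf.comp_quasiMeasurePreserving h1).sub
    (hf.comp_quasiMeasurePreserving Measure.quasiMeasurePreserving_fst)

theorem screenedEnergy_eq_lintegral_prod {n : ℕ} {s p : ℝ} {σ f : Horiz n → ℝ}
    (hσ : Continuous σ) (hf : AEMeasurable f) :
    screenedEnergy s p σ f = ∫⁻ z in {z : Horiz n × Horiz n | ‖z.2‖ < σ z.1},
      ‖f (z.1 + z.2) - f z.1‖ₑ ^ p / ‖z.2‖ₑ ^ (s * p + n) ∂(volume.prod volume) := by
  have hS : MeasurableSet {z : Horiz n × Horiz n | ‖z.2‖ < σ z.1} :=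
    (isOpen_lt (by fun_prop) (by fun_prop)).measurableSet
  have hm : AEMeasurable (fun z : Horiz n × Horiz n =>
      ‖f (z.1 + z.2) - f z.1‖ₑ ^ p / ‖z.2‖ₑ ^ (s * p + n)) (volume.prod volume) :=
    ((aemeasurable_increment hf).enorm.pow_const p).div
      (measurable_snd.enorm.pow_const _).aemeasurable
  rw [← lintegral_indicator hS, lintegral_prod _ (hm.indicator hS)]
  refine lintegral_congr fun x => ?_
  rw [← lintegral_indicator Metric.isOpen_ball.measurableSet]
  refine lintegral_congr fun h => ?_
  simp only [indicator, Metric.mem_ball, dist_zero_right, mem_ofPred_eq]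

theorem screenedSeminorm_ne_top_iff {n : ℕ} {s p : ℝ} (hp : 1 < p) {σ f : Horiz n → ℝ} :
    screenedSeminorm s p σ f ≠ ⊤ ↔ screenedEnergy s p σ f ≠ ⊤ := by
  have : 0 < 1 / p := by positivity
  rw [screenedSeminorm, Ne, ENNReal.rpow_eq_top_iff_of_pos this]

theorem screenedSeminorm_add_ne_top {n : ℕ} {s p : ℝ} (hp : 1 < p) {σ f g : Horiz n → ℝ}
    (hσ : Continuous σ) (hf : AEMeasurable f) (hg : AEMeasurable g)
    (h1 : screenedSeminorm s p σ f ≠ ⊤) (h2 : screenedSeminorm s p σ g ≠ ⊤) :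
    screenedSeminorm s p σ (f + g) ≠ ⊤ := by
  rw [screenedSeminorm_ne_top_iff hp] at h1 h2 ⊢
  rw [screenedEnergy_eq_lintegral_prod hσ hf] at h1
  rw [screenedEnergy_eq_lintegral_prod hσ hg] at h2
  rw [screenedEnergy_eq_lintegral_prod hσ (hf.add hg)]
  have := lintegral_rpow_add_div_ne_top hp (aemeasurable_increment hf).restrict
    (measurable_snd.enorm.pow_const _).aemeasurable h1 h2
  convert this using 5 with z
  simp only [Pi.add_apply]; ring_nf

theorem screenedSeminorm_smul_ne_top {n : ℕ} {s p : ℝ} (hp : 1 < p) {σ f : Horiz n → ℝ}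
    (hσ : Continuous σ) (hf : AEMeasurable f) (c : ℝ)
    (h1 : screenedSeminorm s p σ f ≠ ⊤) : screenedSeminorm s p σ (c • f) ≠ ⊤ := by
  rw [screenedSeminorm_ne_top_iff hp] at h1 ⊢
  rw [screenedEnergy_eq_lintegral_prod hσ hf] at h1
  rw [screenedEnergy_eq_lintegral_prod hσ (hf.const_smul c)]
  have := lintegral_rpow_smul_div_ne_top hp c h1
  convert this using 5 with z
  simp only [Pi.smul_apply, smul_eq_mul]; ring_nf

/-- The screening function `a (ηp - ηm)`. -/
def stripScreen {n : ℕ} (a : ℝ) (ηm ηp : Horiz n → ℝ) : Horiz n → ℝ :=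
  fun x => a * (ηp x - ηm x)

/-- The vector space of boundary data `(f⁻, f⁺)`: both functions belong to `L^p_loc(ℝⁿ)`, their
weighted difference is finite, and both have finite screened seminorm of order `s = 1 - 1/p`
with screening function `a (ηp - ηm)`. -/
def boundaryData {n : ℕ} (p a : ℝ) (ηm ηp : Horiz n → ℝ) (hp : 1 < p)
    (hm : lipSeminorm ηm ≠ ⊤) (hq : lipSeminorm ηp ≠ ⊤) :
    Submodule ℝ ((Horiz n → ℝ) × (Horiz n → ℝ)) where
  carrier := {f | MemLpLoc p f.1 ∧ MemLpLoc p f.2 ∧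
    weightedDiff p ηm ηp f.1 f.2 ≠ ⊤ ∧
    screenedSeminorm (1 - 1 / p) p (stripScreen a ηm ηp) f.1 ≠ ⊤ ∧
    screenedSeminorm (1 - 1 / p) p (stripScreen a ηm ηp) f.2 ≠ ⊤}
  zero_mem' := by
    have h0 : (0 : ℝ) < p := by linarith
    have h : screenedSeminorm (1 - 1 / p) p (stripScreen a ηm ηp) (0 : Horiz n → ℝ) ≠ ⊤ := by
      rw [screenedSeminorm_ne_top_iff hp]
      simp [screenedEnergy, h0]
    exact ⟨fun _ _ => MemLp.zero, fun _ _ => MemLp.zero, by simp [weightedDiff, h0], h, h⟩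
  add_mem' := by
    rintro f g ⟨a1, a2, a3, a4, a5⟩ ⟨b1, b2, b3, b4, b5⟩
    have cm := continuous_of_lipSeminorm_ne_top hm
    have cq := continuous_of_lipSeminorm_ne_top hq
    have hσ : Continuous (stripScreen a ηm ηp) := continuous_const.mul (cq.sub cm)
    refine ⟨fun K hK => (a1 K hK).add (b1 K hK), fun K hK => (a2 K hK).add (b2 K hK), ?_,
      screenedSeminorm_add_ne_top hp hσ (a1.aemeasurable hp) (b1.aemeasurable hp) a4 b4,
      screenedSeminorm_add_ne_top hp hσ (a2.aemeasurable hp) (b2.aemeasurable hp) a5 b5⟩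
    have hw : AEMeasurable (fun x => ENNReal.ofReal ((ηp x - ηm x) ^ (p - 1))) :=
      (((cq.sub cm).measurable.pow_const (p - 1)).ennreal_ofReal).aemeasurable
    have := lintegral_rpow_add_div_ne_top hp
      ((a2.aemeasurable hp).sub (a1.aemeasurable hp)) hw a3 b3
    unfold weightedDiff
    convert this using 5 with z
    simp only [Pi.add_apply, Prod.fst_add, Prod.snd_add, Pi.sub_apply]; ring_nf
  smul_mem' := by
    rintro c f ⟨a1, a2, a3, a4, a5⟩
    have cm := continuous_of_lipSeminorm_ne_top hm
    have cq := continuous_of_lipSeminorm_ne_top hq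
    have hσ : Continuous (stripScreen a ηm ηp) := continuous_const.mul (cq.sub cm)
    refine ⟨fun K hK => (a1 K hK).const_smul c, fun K hK => (a2 K hK).const_smul c, ?_,
      screenedSeminorm_smul_ne_top hp hσ (a1.aemeasurable hp) c a4,
      screenedSeminorm_smul_ne_top hp hσ (a2.aemeasurable hp) c a5⟩
    have := lintegral_rpow_smul_div_ne_top hp c a3
    unfold weightedDiff
    convert this using 5 with z
    simp only [Pi.smul_apply, Prod.smul_fst, Prod.smul_snd, smul_eq_mul]; ring_nf

end

/-! Write `n = N - 1`, let `τ` be the vertical distance of a point to one of the graphs and `d = ηp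
- ηm` the thickness of the strip. The extension is `u = F⁻ + t (F⁺ - F⁻)`, where `F^±` is the
average of `f^±` against a tent of radius `a τ / 2` centred at `x'`, with `τ` measured from the
respective graph, and `t` is the relative height. It is linear in the data by construction.

The tent has known mass, so `f` may be replaced by `f - f(x')` before differentiating. This bounds
the gradient of an average by `1 + L` times the oscillation quotient `τ^(-(n+1)) ∫_{B(x', aτ)} |f -
f(x')|`, up to a constant (`norm_fderiv_tentAvg_le`). Hölder's inequality on the ball and Tonelli in
`τ` turn the `L^p` norm of this quotient into the screened energy: `∫ τ^(-(p+n)) dτ` over `τ >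
|h|/a` is a multiple of `|h|^(-(p+n-1))`, and `τ < d` leaves only `|h| < a d`
(`lintegral_oscQuot_rpow_le`).

The gradient of `t` costs `(1 + L) / d`, but it multiplies `F⁺ - F⁻`, which is at most `d` times the
sum of `|f⁺ - f⁻| / d` and the two oscillation quotients. The `p`-th power of `|f⁺ - f⁻| / d`,
integrated over a vertical fibre of length `d`, is the weighted difference. Hence one majorant in
`L^p(Ω)` controls the gradient (`ae_norm_fderiv_stripExt_le`).

The same majorant controls `(u - f^±) / τ`, and this yields the trace (`hasTrace_of_lipNear`).
Multiply `u ψ` by a cutoff that vanishes near the graphs, use that the integral of a derivative of a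
compactly supported Lipschitz function is zero, and let the width `ε` of the transition layers tend
to zero. The derivative of the cutoff is of size `1/ε` on a layer of vertical width `ε`, so in the
limit it gives an integral over the graph; the error made by replacing `u` with `f^±` vanishes
because `(u - f^±) / τ` is integrable (`tendsto_setIntegral_layer`). As graphs and tents are merely
Lipschitz, all derivatives exist only almost everywhere, by Rademacher's theorem. -/

open Filter Topology

/-! ### Functions that are Lipschitz near a point -/

/-- `f` is Lipschitz on some neighbourhood of `x`. -/
def LipNear {E F : Type*} [PseudoEMetricSpace E] [PseudoEMetricSpace F] (f : E → F) (x : E) :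
    Prop :=
  ∃ C : ℝ≥0, ∃ s ∈ 𝓝 x, LipschitzOnWith C f s

section LipNear

variable {E : Type*} [PseudoEMetricSpace E]

theorem LipschitzWith.lipNear {F : Type*} [PseudoEMetricSpace F] {f : E → F} {C : ℝ≥0}
    (h : LipschitzWith C f) (x : E) : LipNear f x :=
  ⟨C, univ, univ_mem, h.lipschitzOnWith⟩

theorem LipNear.continuousAt {F : Type*} [PseudoEMetricSpace F] {f : E → F} {x : E}
    (h : LipNear f x) : ContinuousAt f x := by
  obtain ⟨C, s, hs, hL⟩ := h
  exact hL.continuousOn.continuousAt hs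

theorem LipNear.comp {F G : Type*} [PseudoEMetricSpace F] [PseudoEMetricSpace G]
    {g : F → G} {f : E → F} {x : E} (hg : LipNear g (f x)) (hf : LipNear f x) :
    LipNear (fun y => g (f y)) x := by
  have hc := hf.continuousAt
  obtain ⟨C, s, hs, hL⟩ := hf
  obtain ⟨D, t, ht, hM⟩ := hg
  exact ⟨D * C, s ∩ f ⁻¹' t, inter_mem hs (hc ht),
    hM.comp (hL.mono inter_subset_left) fun y hy => hy.2⟩

theorem LipNear.prodMk {F G : Type*} [PseudoEMetricSpace F] [PseudoEMetricSpace G]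
    {f : E → F} {g : E → G} {x : E} (hf : LipNear f x) (hg : LipNear g x) :
    LipNear (fun y => (f y, g y)) x := by
  obtain ⟨C, s, hs, hL⟩ := hf
  obtain ⟨D, t, ht, hM⟩ := hg
  exact ⟨max C D, s ∩ t, inter_mem hs ht,
    (hL.mono inter_subset_left).prodMk (hM.mono inter_subset_right)⟩

theorem ContDiffAt.lipNear {E' F' : Type*} [NormedAddCommGroup E'] [NormedSpace ℝ E']
    [NormedAddCommGroup F'] [NormedSpace ℝ F'] {f : E' → F'} {x : E'}
    (hf : ContDiffAt ℝ 1 f x) : LipNear f x :=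
  hf.exists_lipschitzOnWith

theorem LipNear.congr {F : Type*} [PseudoEMetricSpace F] {f g : E → F} {x : E}
    (hf : LipNear f x) (h : f =ᶠ[𝓝 x] g) : LipNear g x := by
  obtain ⟨C, s, hs, hL⟩ := hf
  refine ⟨C, s ∩ {y | f y = g y}, inter_mem hs h, fun y hy z hz => ?_⟩
  rw [← hy.2, ← hz.2]
  exact hL hy.1 hz.1

variable {f g : E → ℝ} {x : E}

/-- The arithmetic operations are C¹ maps on `ℝ × ℝ` (division away from a zero denominator), so
composition suffices for this and the next three statements. -/
theorem LipNear.add (hf : LipNear f x) (hg : LipNear g x) : LipNear (fun y => f y + g y) x :=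
  LipNear.comp (g := fun q : ℝ × ℝ => q.1 + q.2) (f := fun y => (f y, g y))
    (ContDiffAt.lipNear (by fun_prop)) (hf.prodMk hg)

theorem LipNear.sub (hf : LipNear f x) (hg : LipNear g x) : LipNear (fun y => f y - g y) x :=
  LipNear.comp (g := fun q : ℝ × ℝ => q.1 - q.2) (f := fun y => (f y, g y))
    (ContDiffAt.lipNear (by fun_prop)) (hf.prodMk hg)

theorem LipNear.mul (hf : LipNear f x) (hg : LipNear g x) : LipNear (fun y => f y * g y) x :=
  LipNear.comp (g := fun q : ℝ × ℝ => q.1 * q.2) (f := fun y => (f y, g y))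
    (ContDiffAt.lipNear (by fun_prop)) (hf.prodMk hg)

theorem LipNear.div (hf : LipNear f x) (hg : LipNear g x) (h0 : g x ≠ 0) :
    LipNear (fun y => f y / g y) x :=
  LipNear.comp (g := fun q : ℝ × ℝ => q.1 / q.2) (f := fun y => (f y, g y))
    (ContDiffAt.lipNear (ContDiffAt.div (by fun_prop) (by fun_prop) h0)) (hf.prodMk hg)

end LipNear

/-- A locally Lipschitz function with compact support is Lipschitz. -/
theorem exists_lipschitzWith_of_hasCompactSupport {E : Type*} [NormedAddCommGroup E]
    [NormedSpace ℝ E] [FiniteDimensional ℝ E] {g : E → ℝ} (hg : ∀ x, LipNear g x)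
    (hc : HasCompactSupport g) : ∃ C, LipschitzWith C g := by
  have hcont : Continuous g := continuous_iff_continuousAt.2 fun x => (hg x).continuousAt
  obtain ⟨R, hR⟩ := hc.isCompact.isBounded.subset_closedBall 0
  obtain ⟨M, hM⟩ := hcont.bounded_above_of_compact_support hc
  have hM0 : 0 ≤ M := (norm_nonneg _).trans (hM 0)
  obtain ⟨C, hC⟩ := LocallyLipschitzOn.exists_lipschitzOnWith_of_compact
    (isCompact_closedBall (0 : E) (R + 1)) (f := g) (by
      intro x _
      obtain ⟨C, s, hs, hL⟩ := hg x
      exact ⟨C, s, mem_nhdsWithin_of_mem_nhds hs, hL⟩)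
  have h0 : ∀ x, R < ‖x‖ → g x = 0 := by
    intro x hx
    by_contra h
    have := hR (subset_tsupport g h)
    rw [mem_closedBall_zero_iff] at this
    linarith
  -- Pairs inside the ball of radius `R + 1` are covered by compactness. A point of the `R`-ball and
  -- a point outside the larger ball are at distance at least `1`, so there the sup bound `M` serves
  -- as Lipschitz constant.
  have key : ∀ x y : E, ‖x‖ ≤ R → R + 1 < ‖y‖ → |g x - g y| ≤ M * ‖x - y‖ := by
    intro x y hx hy
    rw [h0 y (by linarith), sub_zero]
    have h1 : 1 ≤ ‖x - y‖ := by
      have := norm_sub_norm_le y x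
      rw [norm_sub_rev] at this; linarith
    exact (hM x).trans (le_mul_of_one_le_right hM0 h1)
  refine ⟨C + M.toNNReal, LipschitzWith.of_dist_le_mul fun x y => ?_⟩
  rw [Real.dist_eq, dist_eq_norm, NNReal.coe_add, Real.coe_toNNReal _ hM0]
  have hn := norm_nonneg (x - y)
  have e1 : 0 ≤ (C : ℝ) * ‖x - y‖ := by positivity
  have e2 : 0 ≤ M * ‖x - y‖ := by positivity
  rw [add_mul]
  by_cases hx : ‖x‖ ≤ R + 1
  · by_cases hy : ‖y‖ ≤ R + 1
    · have := hC.dist_le_mul x (by simpa using hx) y (by simpa using hy)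
      rw [Real.dist_eq, dist_eq_norm] at this
      linarith
    · by_cases hx' : ‖x‖ ≤ R
      · linarith [key x y hx' (not_le.1 hy)]
      · rw [h0 x (not_le.1 hx'), h0 y (by linarith [not_le.1 hy])]
        simp only [sub_zero, abs_zero]; linarith
  · by_cases hy : ‖y‖ ≤ R
    · have := key y x hy (not_le.1 hx)
      rw [abs_sub_comm, norm_sub_rev] at this
      linarith
    · rw [h0 y (not_le.1 hy), h0 x (by linarith [not_le.1 hx])]
      simp only [sub_zero, abs_zero]; linarith

/-- Rademacher's theorem for a function that is locally Lipschitz on an open set. -/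
theorem ae_differentiableAt_of_lipNear {E : Type*} [NormedAddCommGroup E]
    [NormedSpace ℝ E] [FiniteDimensional ℝ E] [MeasurableSpace E] [BorelSpace E]
    {μ : Measure E} [μ.IsAddHaarMeasure] {Ω : Set E} {g : E → ℝ} (hg : ∀ x ∈ Ω, LipNear g x) :
    ∀ᵐ x ∂μ, x ∈ Ω → DifferentiableAt ℝ g x := by
  have : μ {x | x ∈ Ω ∧ ¬ DifferentiableAt ℝ g x} = 0 := by
    -- A set that is null near each of its points is null, so Rademacher's theorem need only be
    -- applied on each neighbourhood where `g` is Lipschitz.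
    refine measure_null_of_locally_null _ fun x hx => ?_
    obtain ⟨C, s, hs, hL⟩ := hg x hx.1
    obtain ⟨t, hts, hto, hxt⟩ := mem_nhds_iff.1 hs
    refine ⟨t ∩ {x | ¬ DifferentiableAt ℝ g x},
      mem_nhdsWithin.2 ⟨t, hto, hxt, fun y hy => ⟨hy.1, hy.2.2⟩⟩, ?_⟩
    have := (hL.mono hts).ae_differentiableWithinAt_of_mem (μ := μ)
    rw [ae_iff] at this
    refine measure_mono_null ?_ this
    rintro y ⟨hy1, hy2⟩ h
    exact hy2 ((h hy1).differentiableAt (hto.mem_nhds hy1))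
  rw [ae_iff]
  convert this using 3
  simp

/-! ### Averages against a tent function of variable radius -/

noncomputable section

/-- The integral of the tent `(1 - |y|)₊` over `ℝⁿ`. -/
def tentMass (n : ℕ) : ℝ := ∫ y : Horiz n, max (1 - ‖y‖) 0

/-- The unnormalized average of `f` against the tent of radius `ρ x` centred at `x'`. -/
def tentInt {n : ℕ} (ρ : Horiz n × ℝ → ℝ) (f : Horiz n → ℝ) (x : Horiz n × ℝ) : ℝ :=
  ∫ z, f z * max (ρ x - ‖z - x.1‖) 0

/-- The average of `f` against the tent of radius `ρ x` centred at `x'`. -/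
def tentAvg {n : ℕ} (ρ : Horiz n × ℝ → ℝ) (f : Horiz n → ℝ) (x : Horiz n × ℝ) : ℝ :=
  tentInt ρ f x / (tentMass n * ρ x ^ (n + 1))

/-- The integral of `|f - f y|` over the ball of radius `r` around `y`. -/
def ballOsc {n : ℕ} (f : Horiz n → ℝ) (r : ℝ) (y : Horiz n) : ℝ :=
  ∫ z in Metric.ball y r, |f z - f y|

variable {n : ℕ}

theorem integrable_tent (r : ℝ) (y : Horiz n) :
    Integrable (fun z : Horiz n => max (r - ‖z - y‖) 0) := by
  refine Continuous.integrable_of_hasCompactSupport (by fun_prop) ?_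
  refine HasCompactSupport.intro (isCompact_closedBall y r) fun z hz => ?_
  rw [Metric.mem_closedBall, dist_eq_norm, not_le] at hz
  exact max_eq_right (by linarith)

theorem tentMass_pos (n : ℕ) : 0 < tentMass n := by
  have hi := integrable_tent (n := n) 1 0
  simp only [sub_zero] at hi
  refine (integral_pos_iff_support_of_nonneg (fun y => le_max_right _ _) hi).2 ?_
  refine (Metric.measure_ball_pos volume (0 : Horiz n) one_pos).trans_le (measure_mono ?_)
  intro y hy
  rw [mem_ball_zero_iff] at hy
  exact (lt_max_of_lt_left (by linarith)).ne'

/-- Scaling by `r` contributes `r ^ n` from the volume and one more factor `r` from the height of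
the tent. -/
theorem integral_tent {r : ℝ} (hr : 0 < r) (y : Horiz n) :
    ∫ z : Horiz n, max (r - ‖z - y‖) 0 = tentMass n * r ^ (n + 1) := by
  rw [integral_sub_right_eq_self (fun z : Horiz n => max (r - ‖z‖) 0) y]
  have h := Measure.integral_comp_smul_of_nonneg (volume : Measure (Horiz n))
    (fun z => max (r - ‖z‖) 0) r (hR := hr.le)
  have h2 : ∀ z : Horiz n, max (r - ‖r • z‖) 0 = r * max (1 - ‖z‖) 0 := by
    intro z
    rw [norm_smul, Real.norm_of_nonneg hr.le, mul_max_of_nonneg _ _ hr.le]; ring_nf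
  simp only [h2, integral_const_mul, finrank_euclideanSpace, Fintype.card_fin, smul_eq_mul] at h
  rw [tentMass]
  field_simp at h
  rw [pow_succ]; linarith

theorem integrable_mul_tent {f : Horiz n → ℝ} (hf : LocallyIntegrable f) (r : ℝ) (y : Horiz n) :
    Integrable (fun z => f z * max (r - ‖z - y‖) 0) := by
  have h := hf.integrable_smul_left_of_hasCompactSupport
    (g := fun z : Horiz n => max (r - ‖z - y‖) 0) (by fun_prop) (by
      refine HasCompactSupport.intro (isCompact_closedBall y r) fun z hz => ?_
      rw [Metric.mem_closedBall, dist_eq_norm, not_le] at hz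
      exact max_eq_right (by linarith))
  simpa [mul_comm] using h

theorem integrableOn_ball_of_locallyIntegrable {f : Horiz n → ℝ} (hf : LocallyIntegrable f) (y : Horiz n)
    (r : ℝ) : IntegrableOn f (Metric.ball y r) :=
  (hf.integrableOn_isCompact (isCompact_closedBall y r)).mono_set Metric.ball_subset_closedBall

/-- For fixed `z` the kernel `max (ρ x - ‖z - x'‖) 0` is Lipschitz in `x` with constant `1 + Λ`, and
the hypotheses on `R` keep both supports in the ball around `y`. -/
theorem abs_tentInt_sub_le {f : Horiz n → ℝ} (hf : LocallyIntegrable f) {ρ : Horiz n × ℝ → ℝ}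
    {Λ : ℝ≥0} (hρ : LipschitzWith Λ ρ) {y : Horiz n} {R : ℝ} {x₁ x₂ : Horiz n × ℝ}
    (h1 : ‖x₁.1 - y‖ + ρ x₁ ≤ R) (h2 : ‖x₂.1 - y‖ + ρ x₂ ≤ R) :
    |tentInt ρ f x₁ - tentInt ρ f x₂| ≤
      (1 + Λ) * (∫ z in Metric.ball y R, |f z|) * ‖x₁ - x₂‖ := by
  have hker : ∀ z : Horiz n,
      |max (ρ x₁ - ‖z - x₁.1‖) 0 - max (ρ x₂ - ‖z - x₂.1‖) 0| ≤ (1 + Λ) * ‖x₁ - x₂‖ := by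
    intro z
    refine (abs_max_sub_max_le_abs _ _ _).trans ?_
    have a1 := hρ.dist_le_mul x₁ x₂
    rw [Real.dist_eq, dist_eq_norm] at a1
    have a2 : |‖z - x₁.1‖ - ‖z - x₂.1‖| ≤ ‖x₁ - x₂‖ := by
      refine (abs_norm_sub_norm_le _ _).trans ?_
      rw [show z - x₁.1 - (z - x₂.1) = -(x₁ - x₂).1 by simp, norm_neg]
      exact norm_fst_le _
    calc |ρ x₁ - ‖z - x₁.1‖ - (ρ x₂ - ‖z - x₂.1‖)|
        = |(ρ x₁ - ρ x₂) - (‖z - x₁.1‖ - ‖z - x₂.1‖)| := by ring_nf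
      _ ≤ |ρ x₁ - ρ x₂| + |‖z - x₁.1‖ - ‖z - x₂.1‖| := abs_sub _ _
      _ ≤ _ := by linarith
  have hzero : ∀ x : Horiz n × ℝ, ‖x.1 - y‖ + ρ x ≤ R → ∀ z ∉ Metric.ball y R,
      max (ρ x - ‖z - x.1‖) 0 = 0 := by
    intro x hx z hz
    rw [Metric.mem_ball, dist_eq_norm, not_lt] at hz
    refine max_eq_right ?_
    have := norm_sub_le_norm_sub_add_norm_sub z x.1 y
    linarith
  have hi : IntegrableOn (fun z => |f z|) (Metric.ball y R) :=
    (integrableOn_ball_of_locallyIntegrable hf y R).norm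
  rw [tentInt, tentInt, ← integral_sub (integrable_mul_tent hf _ _) (integrable_mul_tent hf _ _),
    ← Real.norm_eq_abs]
  have hle : ∀ z, ‖f z * max (ρ x₁ - ‖z - x₁.1‖) 0 - f z * max (ρ x₂ - ‖z - x₂.1‖) 0‖ ≤
      (Metric.ball y R).indicator (fun z => ((1 + Λ) * ‖x₁ - x₂‖) * |f z|) z := by
    intro z
    by_cases hz : z ∈ Metric.ball y R
    · rw [indicator_of_mem hz, ← mul_sub, Real.norm_eq_abs, abs_mul, mul_comm]
      exact mul_le_mul_of_nonneg_right (hker z) (abs_nonneg _)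
    · rw [indicator_of_notMem hz, hzero _ h1 z hz, hzero _ h2 z hz]; simp
  refine (norm_integral_le_of_norm_le (IntegrableOn.integrable_indicator (hi.const_mul _)
    Metric.isOpen_ball.measurableSet) (Eventually.of_forall hle)).trans ?_
  rw [integral_indicator Metric.isOpen_ball.measurableSet, integral_const_mul]
  exact le_of_eq (by ring)

/-- The constant `c` integrates to `c` times the mass of the tent. The product form lets the average
be differentiated through the product rule, with `c` chosen as the value of `f` at the centre. -/
theorem tentInt_sub_const {f : Horiz n → ℝ} (hf : LocallyIntegrable f) {ρ : Horiz n × ℝ → ℝ}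
    {x : Horiz n × ℝ} (hx : 0 < ρ x) (c : ℝ) :
    tentInt ρ (fun z => f z - c) x = (tentAvg ρ f x - c) * (tentMass n * ρ x ^ (n + 1)) := by
  have hD : tentMass n * ρ x ^ (n + 1) ≠ 0 := (mul_pos (tentMass_pos n) (pow_pos hx _)).ne'
  rw [sub_mul, tentAvg, div_mul_cancel₀ _ hD, ← integral_tent hx x.1, ← integral_const_mul,
    tentInt, tentInt, ← integral_sub (integrable_mul_tent hf _ _)
      ((integrable_tent _ _).const_mul c)]
  simp only [sub_mul]

theorem ballOsc_nonneg (f : Horiz n → ℝ) (r : ℝ) (y : Horiz n) : 0 ≤ ballOsc f r y :=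
  integral_nonneg fun _ => abs_nonneg _

/-- The kernel is at most `ρ x` and lives in the ball of radius `ρ x`. The larger radius `2 * ρ x`
is used so that the same oscillation appears here and in the gradient bound. -/
theorem abs_tentAvg_sub_le {f : Horiz n → ℝ} (hf : LocallyIntegrable f) {ρ : Horiz n × ℝ → ℝ}
    {x : Horiz n × ℝ} (hx : 0 < ρ x) :
    |tentAvg ρ f x - f x.1| ≤ ρ x * (ballOsc f (2 * ρ x) x.1 / ρ x ^ (n + 1)) / tentMass n := by
  have hm := tentMass_pos n
  have h := tentInt_sub_const hf hx (f x.1)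
  have hg : LocallyIntegrable fun z => f z - f x.1 := hf.sub (locallyIntegrable_const _)
  have hi : IntegrableOn (fun z => |f z - f x.1|) (Metric.ball x.1 (2 * ρ x)) :=
    (integrableOn_ball_of_locallyIntegrable hg _ _).norm
  have hle : ∀ z, ‖(f z - f x.1) * max (ρ x - ‖z - x.1‖) 0‖ ≤
      (Metric.ball x.1 (2 * ρ x)).indicator (fun z => ρ x * |f z - f x.1|) z := by
    intro z
    by_cases hz : z ∈ Metric.ball x.1 (2 * ρ x)
    · rw [indicator_of_mem hz, Real.norm_eq_abs, abs_mul, mul_comm]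
      refine mul_le_mul_of_nonneg_right ?_ (abs_nonneg _)
      rw [abs_of_nonneg (le_max_right _ _)]
      exact max_le (by linarith [norm_nonneg (z - x.1)]) hx.le
    · rw [indicator_of_notMem hz]
      rw [Metric.mem_ball, dist_eq_norm, not_lt] at hz
      rw [max_eq_right (by linarith)]; simp
  have h2 : |tentInt ρ (fun z => f z - f x.1) x| ≤ ρ x * ballOsc f (2 * ρ x) x.1 := by
    rw [tentInt, ← Real.norm_eq_abs]
    refine (norm_integral_le_of_norm_le (IntegrableOn.integrable_indicator (hi.const_mul _)
      Metric.isOpen_ball.measurableSet) (Eventually.of_forall hle)).trans ?_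
    rw [integral_indicator Metric.isOpen_ball.measurableSet, integral_const_mul, ballOsc]
  have hD : 0 < tentMass n * ρ x ^ (n + 1) := mul_pos hm (pow_pos hx _)
  rw [h, abs_mul, abs_of_pos hD, ← le_div_iff₀ hD] at h2
  refine h2.trans (le_of_eq ?_)
  field_simp

theorem lipNear_tentAvg {f : Horiz n → ℝ} (hf : LocallyIntegrable f) {ρ : Horiz n × ℝ → ℝ}
    {Λ : ℝ≥0} (hρ : LipschitzWith Λ ρ) {x : Horiz n × ℝ} (hx : 0 < ρ x) :
    LipNear (tentAvg ρ f) x := by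
  have hN : LipNear (tentInt ρ f) x := by
    -- Any radius larger than `ρ x` works: the kernels of all nearby points are then supported in
    -- one ball.
    set R : ℝ := ρ x + 1
    set C : ℝ := (1 + Λ) * (∫ z in Metric.ball x.1 R, |f z|)
    have hC : 0 ≤ C := mul_nonneg (by positivity) (integral_nonneg fun _ => abs_nonneg _)
    have hU : {y : Horiz n × ℝ | ‖y.1 - x.1‖ + ρ y < R} ∈ 𝓝 x := by
      refine (isOpen_lt ?_ continuous_const).mem_nhds ?_
      · have := hρ.continuous; fun_prop
      · simp [R]
    refine ⟨C.toNNReal, _, hU, LipschitzOnWith.of_dist_le_mul fun y hy z hz => ?_⟩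
    rw [Real.dist_eq, dist_eq_norm, Real.coe_toNNReal _ hC]
    exact abs_tentInt_sub_le hf hρ (le_of_lt hy) (le_of_lt hz)
  have hD : LipNear (fun y => tentMass n * ρ y ^ (n + 1)) x :=
    LipNear.comp (g := fun r : ℝ => tentMass n * r ^ (n + 1))
      (ContDiffAt.lipNear (by fun_prop)) (hρ.lipNear x)
  exact hN.div hD (mul_pos (tentMass_pos n) (pow_pos hx _)).ne'

/-- With `c = f x'` frozen, `tentInt ρ (f - c) = (F - c) D` near `x`, where `F` is the average and
`D` the mass of the tent. The left side is Lipschitz at `x` with constant `(1 + Λ) O`, where `O` is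
the oscillation, so the product rule can be solved for `D F'`. The remaining term `(F - c) D'` is at
most `(n + 1) Λ O`, since `F - c` is itself bounded by the oscillation. -/
theorem norm_fderiv_tentAvg_le {f : Horiz n → ℝ} (hf : LocallyIntegrable f)
    {ρ : Horiz n × ℝ → ℝ} {Λ : ℝ≥0} (hρ : LipschitzWith Λ ρ) {x : Horiz n × ℝ} (hx : 0 < ρ x)
    (hρx : DifferentiableAt ℝ ρ x) (hFx : DifferentiableAt ℝ (tentAvg ρ f) x) :
    ‖fderiv ℝ (tentAvg ρ f) x‖ ≤
      ((n + 2) * (1 + Λ) / tentMass n) * (ballOsc f (2 * ρ x) x.1 / ρ x ^ (n + 1)) := by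
  have hm := tentMass_pos n
  set m := tentMass n
  set O := ballOsc f (2 * ρ x) x.1
  have hO : 0 ≤ O := ballOsc_nonneg _ _ _
  set g : Horiz n → ℝ := fun z => f z - f x.1
  have hg : LocallyIntegrable g := hf.sub (locallyIntegrable_const _)
  have hρc := hρ.continuous
  have hev : tentInt ρ g =ᶠ[𝓝 x] fun y => (tentAvg ρ f y - f x.1) * (m * ρ y ^ (n + 1)) := by
    filter_upwards [(isOpen_lt continuous_const hρc).mem_nhds hx] with y hy
    exact tentInt_sub_const hf hy _
  have hD : HasFDerivAt (fun y => m * ρ y ^ (n + 1))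
      (m • (((n + 1 : ℕ) * ρ x ^ n) • fderiv ℝ ρ x)) x := by
    have := (hρx.hasFDerivAt.pow (n + 1)).const_mul m
    simpa using this
  have hprod := ((hFx.hasFDerivAt.sub_const (f x.1)).mul hD).congr_of_eventuallyEq hev
  have hlip := hprod.le_of_lip' (C := (1 + Λ) * O) (by positivity) (by
    -- Radius `2 * ρ x` rather than `ρ x` leaves room for the supports of the kernels at
    -- neighbouring points.
    have hU : {y : Horiz n × ℝ | ‖y.1 - x.1‖ + ρ y < 2 * ρ x} ∈ 𝓝 x := by
      refine (isOpen_lt (by fun_prop) continuous_const).mem_nhds ?_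
      simp only [mem_ofPred_eq, sub_self, norm_zero]; linarith
    filter_upwards [hU] with y hy
    exact abs_tentInt_sub_le hg hρ (le_of_lt hy) (by simp; linarith))
  have hρn : ‖fderiv ℝ ρ x‖ ≤ Λ := norm_fderiv_le_of_lipschitz ℝ hρ
  have hF := abs_tentAvg_sub_le hf hx
  set F' := fderiv ℝ (tentAvg ρ f) x
  set D := m * ρ x ^ (n + 1) with hDdef
  have hDpos : 0 < D := by positivity
  have h3 : ‖D • F'‖ ≤ (1 + Λ) * O + (n + 1) * Λ * O := by
    set A := (tentAvg ρ f x - f x.1) • (m • (((n + 1 : ℕ) * ρ x ^ n) • fderiv ℝ ρ x)) with hA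
    have hAn : ‖A‖ ≤ (n + 1) * Λ * O := by
      rw [hA, norm_smul, norm_smul, norm_smul, Real.norm_eq_abs, Real.norm_eq_abs,
        Real.norm_eq_abs, abs_of_pos hm,
        abs_of_nonneg (by positivity : (0 : ℝ) ≤ ((n + 1 : ℕ) : ℝ) * ρ x ^ n)]
      calc |tentAvg ρ f x - f x.1| * (m * (((n + 1 : ℕ) : ℝ) * ρ x ^ n * ‖fderiv ℝ ρ x‖))
          ≤ (ρ x * (O / ρ x ^ (n + 1)) / m) * (m * (((n + 1 : ℕ) : ℝ) * ρ x ^ n * Λ)) := by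
            gcongr
        _ = _ := by push_cast; field_simp; ring
    have : D • F' = (A + D • F') - A := by abel
    rw [this]
    exact (norm_sub_le _ _).trans (add_le_add hlip hAn)
  rw [norm_smul, Real.norm_of_nonneg hDpos.le, mul_comm, ← le_div_iff₀ hDpos] at h3
  refine h3.trans ?_
  rw [div_mul_div_comm]
  refine div_le_div_of_nonneg_right ?_ hDpos.le
  have : (0 : ℝ) ≤ Λ := Λ.2
  nlinarith [mul_nonneg (Nat.cast_nonneg n : (0 : ℝ) ≤ n) hO]

/-! ### Linearity of the averages and independence of the representative. -/

theorem tentInt_add {f g : Horiz n → ℝ} (hf : LocallyIntegrable f) (hg : LocallyIntegrable g)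
    (ρ : Horiz n × ℝ → ℝ) (x : Horiz n × ℝ) :
    tentInt ρ (f + g) x = tentInt ρ f x + tentInt ρ g x := by
  rw [tentInt, tentInt, tentInt, ← integral_add (integrable_mul_tent hf _ _)
    (integrable_mul_tent hg _ _)]
  simp only [Pi.add_apply, add_mul]

theorem tentAvg_add {f g : Horiz n → ℝ} (hf : LocallyIntegrable f) (hg : LocallyIntegrable g)
    (ρ : Horiz n × ℝ → ℝ) (x : Horiz n × ℝ) :
    tentAvg ρ (f + g) x = tentAvg ρ f x + tentAvg ρ g x := by
  rw [tentAvg, tentInt_add hf hg, add_div]; rfl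

theorem tentAvg_smul (c : ℝ) (f : Horiz n → ℝ) (ρ : Horiz n × ℝ → ℝ) (x : Horiz n × ℝ) :
    tentAvg ρ (c • f) x = c * tentAvg ρ f x := by
  rw [tentAvg, tentAvg, tentInt, tentInt, ← mul_div_assoc, ← integral_const_mul]
  simp only [Pi.smul_apply, smul_eq_mul, mul_assoc]

theorem tentAvg_congr_ae {f g : Horiz n → ℝ} (h : f =ᵐ[volume] g) (ρ : Horiz n × ℝ → ℝ)
    (x : Horiz n × ℝ) : tentAvg ρ f x = tentAvg ρ g x := by
  rw [tentAvg, tentAvg, tentInt, tentInt]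
  congr 1
  exact integral_congr_ae (h.mono fun z hz => by simp only [hz])

end

noncomputable section

/-! ### Integrals over thin layers along a graph -/

/-- Every vertical fibre of the layer `ε < τ < 2ε` has length `ε`, so by Fubini `A / ε` integrates
over the layer to exactly `∫ A`. The error `(Φ - A) / ε` equals `(Φ - A) / τ` times `τ / ε < 2`, so
it is dominated by an integrable function, and at each point it vanishes once `2ε` is below `τ`. -/
theorem tendsto_setIntegral_layer {n : ℕ} {τ : Horiz n × ℝ → ℝ} (hτ : Measurable τ)
    (hτv : ∀ x : Horiz n, ∀ ε > 0,
      volume {s : ℝ | ε < τ (x, s) ∧ τ (x, s) < 2 * ε} = ENNReal.ofReal ε)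
    {δ : ℝ} (hδ : 0 < δ) {Φ : Horiz n × ℝ → ℝ} {A : Horiz n → ℝ} (hA : Integrable A)
    (hΦ : IntegrableOn (fun x => (Φ x - A x.1) / τ x) {x | 0 < τ x ∧ τ x < δ}) :
    (∀ᶠ ε in 𝓝[>] (0 : ℝ),
      IntegrableOn (fun x => Φ x / ε) {x | ε < τ x ∧ τ x < 2 * ε}) ∧
    Tendsto (fun ε => ∫ x in {x | ε < τ x ∧ τ x < 2 * ε}, Φ x / ε) (𝓝[>] (0 : ℝ))
      (𝓝 (∫ x, A x)) := by
  have hLm : ∀ ε : ℝ, MeasurableSet {x | ε < τ x ∧ τ x < 2 * ε} := fun ε =>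
    (measurableSet_lt measurable_const hτ).inter (measurableSet_lt hτ measurable_const)
  have hev : ∀ᶠ ε in 𝓝[>] (0 : ℝ), 0 < ε ∧ 2 * ε < δ := by
    have : Ioo (0 : ℝ) (δ / 2) ∈ 𝓝[>] (0 : ℝ) := Ioo_mem_nhdsGT (by positivity)
    filter_upwards [this] with ε hε
    exact ⟨hε.1, by linarith [hε.2]⟩
  have hsub : ∀ ε : ℝ, 0 < ε → 2 * ε < δ →
      {x | ε < τ x ∧ τ x < 2 * ε} ⊆ {x | 0 < τ x ∧ τ x < δ} :=
    fun ε h0 h1 x hx => ⟨h0.trans hx.1, hx.2.trans h1⟩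
  -- the remainder
  set D : Set (Horiz n × ℝ) := {x | 0 < τ x ∧ τ x < δ} with hD
  have hDm : MeasurableSet D :=
    (measurableSet_lt measurable_const hτ).inter (measurableSet_lt hτ measurable_const)
  set q : Horiz n × ℝ → ℝ := fun x => (Φ x - A x.1) / τ x with hq
  set w : ℝ → Horiz n × ℝ → ℝ := fun ε x =>
    ({x | ε < τ x ∧ τ x < 2 * ε} : Set (Horiz n × ℝ)).indicator (fun x => q x * (τ x / ε)) x
    with hw
  have hwm : ∀ ε, AEStronglyMeasurable (w ε) (volume.restrict D) := fun ε =>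
    (hΦ.aestronglyMeasurable.mul (hτ.div_const ε).aestronglyMeasurable).indicator (hLm ε)
  have hwle : ∀ ε, 0 < ε → ∀ x, ‖w ε x‖ ≤ 2 * ‖q x‖ := by
    intro ε h0 x
    by_cases hx : x ∈ {x | ε < τ x ∧ τ x < 2 * ε}
    · simp only [hw]
      rw [indicator_of_mem hx, norm_mul, mul_comm]
      refine mul_le_mul_of_nonneg_right ?_ (norm_nonneg _)
      rw [Real.norm_of_nonneg (div_nonneg (h0.trans hx.1).le h0.le), div_le_iff₀ h0]
      exact hx.2.le
    · simp only [hw]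
      rw [indicator_of_notMem hx]; simp
  have hbound : Integrable (fun x => 2 * ‖q x‖) (volume.restrict D) := hΦ.norm.const_mul 2
  have hlim : Tendsto (fun ε => ∫ x in D, w ε x) (𝓝[>] (0 : ℝ)) (𝓝 0) := by
    have := tendsto_integral_filter_of_dominated_convergence (μ := volume.restrict D)
      (l := 𝓝[>] (0 : ℝ)) (F := w) (f := fun _ => 0) (fun x => 2 * ‖q x‖)
      (Eventually.of_forall hwm) (by
        filter_upwards [self_mem_nhdsWithin] with ε hε
        exact Eventually.of_forall (hwle ε hε)) hbound (by
        filter_upwards [ae_restrict_mem hDm] with x hx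
        refine tendsto_const_nhds.congr' ?_
        have : Ioo (0 : ℝ) (τ x / 2) ∈ 𝓝[>] (0 : ℝ) := Ioo_mem_nhdsGT (by have := hx.1; positivity)
        filter_upwards [this] with ε hε
        rw [hw]; simp only
        rw [indicator_of_notMem]
        rintro ⟨_, h⟩
        linarith [hε.2])
    simpa using this
  -- the main term
  have hAi : ∀ ε : ℝ, 0 < ε →
      Integrable (({x | ε < τ x ∧ τ x < 2 * ε} : Set (Horiz n × ℝ)).indicator
        fun x => A x.1 / ε) ∧
      ∫ x in {x | ε < τ x ∧ τ x < 2 * ε}, A x.1 / ε = ∫ x, A x := by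
    intro ε h0
    have hcoe : ∀ x s, ({x | ε < τ x ∧ τ x < 2 * ε} : Set (Horiz n × ℝ)).indicator
        (fun x => A x.1 / ε) (x, s) =
        ({s : ℝ | ε < τ (x, s) ∧ τ (x, s) < 2 * ε}).indicator (fun _ => A x / ε) s := by
      intro x s
      simp only [indicator, mem_ofPred_eq]
    have hms : ∀ x : Horiz n, MeasurableSet {s : ℝ | ε < τ (x, s) ∧ τ (x, s) < 2 * ε} := fun x =>
      (hLm ε).preimage (measurable_prodMk_left (x := x))
    have hreal : ∀ x : Horiz n,
        (volume : Measure ℝ).real {s : ℝ | ε < τ (x, s) ∧ τ (x, s) < 2 * ε} = ε := by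
      intro x
      rw [measureReal_def, hτv x ε h0, ENNReal.toReal_ofReal h0.le]
    have hint : Integrable (({x | ε < τ x ∧ τ x < 2 * ε} : Set (Horiz n × ℝ)).indicator
        fun x => A x.1 / ε) := by
      rw [Measure.volume_eq_prod, integrable_prod_iff]
      · constructor
        · refine Eventually.of_forall fun x => ?_
          simp only [hcoe]
          rw [integrable_indicator_iff (hms x)]
          exact integrableOn_const (by rw [hτv x ε h0]; exact ENNReal.ofReal_ne_top)
        · simp only [hcoe, norm_indicator_eq_indicator_norm]
          refine hA.norm.congr (Eventually.of_forall fun x => ?_)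
          simp only
          rw [integral_indicator (hms x), setIntegral_const, hreal, norm_div,
            Real.norm_of_nonneg h0.le, smul_eq_mul]
          field_simp
      · refine AEStronglyMeasurable.indicator ?_ (hLm ε)
        simp only [div_eq_mul_inv]
        exact (hA.aestronglyMeasurable.comp_fst).mul_const _
    refine ⟨hint, ?_⟩
    rw [← integral_indicator (hLm ε), Measure.volume_eq_prod, integral_prod _ hint]
    refine integral_congr_ae (Eventually.of_forall fun x => ?_)
    simp only [hcoe]
    rw [integral_indicator (hms x), setIntegral_const, hreal, smul_eq_mul]
    field_simp
  have hsplit : ∀ ε : ℝ, 0 < ε → ∀ x ∈ {x | ε < τ x ∧ τ x < 2 * ε},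
      Φ x / ε = A x.1 / ε + w ε x := by
    intro ε h0 x hx
    have h1 : τ x ≠ 0 := (h0.trans hx.1).ne'
    rw [hw]; simp only
    rw [indicator_of_mem hx, hq]
    field_simp
    ring
  have hwi : ∀ ε : ℝ, 0 < ε → IntegrableOn (w ε) D := fun ε h0 =>
    hbound.mono' (hwm ε) (Eventually.of_forall (hwle ε h0))
  constructor
  · filter_upwards [hev] with ε hε
    refine IntegrableOn.congr_fun (f := fun x => A x.1 / ε + w ε x) ?_
      (fun x hx => (hsplit ε hε.1 x hx).symm) (hLm ε)
    exact Integrable.add ((integrable_indicator_iff (hLm ε)).1 (hAi ε hε.1).1)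
      ((hwi ε hε.1).mono_set (hsub ε hε.1 hε.2))
  · have : Tendsto (fun ε => (∫ x, A x) + ∫ x in D, w ε x) (𝓝[>] (0 : ℝ))
        (𝓝 ((∫ x, A x) + 0)) := tendsto_const_nhds.add hlim
    rw [add_zero] at this
    refine this.congr' ?_
    filter_upwards [hev] with ε hε
    rw [setIntegral_congr_fun (hLm ε) (hsplit ε hε.1), integral_add
      ((integrable_indicator_iff (hLm ε)).1 (hAi ε hε.1).1)
      ((hwi ε hε.1).mono_set (hsub ε hε.1 hε.2)), (hAi ε hε.1).2]
    congr 1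
    refine (setIntegral_eq_of_subset_of_forall_sdiff_eq_zero hDm (hsub ε hε.1 hε.2) ?_)
    intro x hx
    exact indicator_of_notMem hx.2 _

/-- Integrals over thin layers along a graph, for a test function times a function with prescribed
boundary values on the graph. The sign `σ` tells on which side of the graph the layers lie. -/
theorem tendsto_setIntegral_layer_mul {n : ℕ} {σ : ℝ} (hσ : |σ| = 1) {η : Horiz n → ℝ} {Λ : ℝ≥0}
    (hη : LipschitzWith Λ η) {Ω : Set (Horiz n × ℝ)}
    {u : Horiz n × ℝ → ℝ} {f : Horiz n → ℝ} (hf : LocallyIntegrable f)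
    (hu : ∀ K : Set (Horiz n × ℝ), IsCompact K →
      IntegrableOn (fun x => (u x - f x.1) / (σ * (x.2 - η x.1))) (Ω ∩ K))
    {ψ : Horiz n × ℝ → ℝ} (hψ : ContDiff ℝ 1 ψ) (hψc : HasCompactSupport ψ) {δ : ℝ} (hδ : 0 < δ)
    (hsub : ∀ x : Horiz n × ℝ, x.1 ∈ Prod.fst '' tsupport ψ → 0 < σ * (x.2 - η x.1) →
      σ * (x.2 - η x.1) < δ → x ∈ Ω) (v : Horiz n × ℝ) :
    (∀ᶠ ε in 𝓝[>] (0 : ℝ),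
      IntegrableOn (fun x => u x * ψ x * (v.2 - fderiv ℝ η x.1 v.1) / ε)
        {x | ε < σ * (x.2 - η x.1) ∧ σ * (x.2 - η x.1) < 2 * ε}) ∧
    Tendsto (fun ε => ∫ x in {x | ε < σ * (x.2 - η x.1) ∧ σ * (x.2 - η x.1) < 2 * ε},
        u x * ψ x * (v.2 - fderiv ℝ η x.1 v.1) / ε) (𝓝[>] (0 : ℝ))
      (𝓝 (∫ x, ψ (x, η x) * f x * (v.2 - fderiv ℝ η x v.1))) := by
  have hηc := hη.continuous
  have hψcont := hψ.continuous
  obtain ⟨C, hC⟩ := hψ.lipschitzWith_of_hasCompactSupport hψc one_ne_zero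
  obtain ⟨M, hM⟩ := hψcont.bounded_above_of_compact_support hψc
  set κ : Horiz n → ℝ := fun x => v.2 - fderiv ℝ η x v.1 with hκ
  have hκm : Measurable κ := measurable_const.sub (measurable_fderiv_apply_const ℝ η v.1)
  set B : ℝ := ‖v.2‖ + Λ * ‖v.1‖ with hB
  have hB0 : 0 ≤ B := by positivity
  have hκb : ∀ x, ‖κ x‖ ≤ B := fun x => by
    refine (norm_sub_le _ _).trans (add_le_add le_rfl ?_)
    exact (ContinuousLinearMap.le_opNorm _ _).trans
      (mul_le_mul_of_nonneg_right (norm_fderiv_le_of_lipschitz ℝ hη) (norm_nonneg _))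
  have hτm : Continuous fun x : Horiz n × ℝ => σ * (x.2 - η x.1) := by fun_prop
  set K' : Set (Horiz n) := Prod.fst '' tsupport ψ with hK'
  have hK'c : IsCompact K' := hψc.isCompact.image continuous_fst
  have hψ0 : ∀ x : Horiz n × ℝ, x.1 ∉ K' → ψ x = 0 := by
    intro x hx
    by_contra h
    exact hx ⟨x, subset_tsupport ψ h, rfl⟩
  have hσ2 : σ * σ = 1 := by rw [← abs_mul_abs_self, hσ, one_mul]
  refine tendsto_setIntegral_layer hτm.measurable ?_ hδ
    (A := fun x => ψ (x, η x) * f x * κ x) ?_ ?_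
  -- For either sign the fibre of the layer is an interval of length `ε`, above or below the graph.
  · intro x ε hε
    simp only
    rcases (abs_eq zero_le_one).1 hσ with rfl | rfl
    · have : {s : ℝ | ε < 1 * (s - η x) ∧ 1 * (s - η x) < 2 * ε} =
          Ioo (η x + ε) (η x + 2 * ε) := by
        ext s; simp only [mem_ofPred_eq, mem_Ioo]
        constructor <;> rintro ⟨h1, h2⟩ <;> constructor <;> linarith
      rw [this, Real.volume_Ioo]; congr 1; ring
    · have : {s : ℝ | ε < -1 * (s - η x) ∧ -1 * (s - η x) < 2 * ε} =
          Ioo (η x - 2 * ε) (η x - ε) := by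
        ext s; simp only [mem_ofPred_eq, mem_Ioo]
        constructor <;> rintro ⟨h1, h2⟩ <;> constructor <;> linarith
      rw [this, Real.volume_Ioo]; congr 1; ring
  · have h1 : Integrable (fun x => ψ (x, η x) * f x) := by
      have := hf.integrable_smul_left_of_hasCompactSupport (g := fun x => ψ (x, η x))
        (by fun_prop) (HasCompactSupport.intro hK'c fun x hx => hψ0 _ hx)
      simpa using this
    exact h1.mul_bdd (c := B) hκm.aestronglyMeasurable (Eventually.of_forall hκb)
  · obtain ⟨T, hT⟩ := (hK'c.image hηc).isBounded.exists_norm_le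
    -- A compact box that contains the whole layer of width `δ` above `K'`; outside it `ψ` plays no
    -- role.
    set K'' : Set (Horiz n × ℝ) := K' ×ˢ Icc (-(T + δ)) (T + δ) with hK''
    have hK''c : IsCompact K'' := hK'c.prod isCompact_Icc
    set D : Set (Horiz n × ℝ) := {x | 0 < σ * (x.2 - η x.1) ∧ σ * (x.2 - η x.1) < δ} with hD
    have hDm : MeasurableSet D := (isOpen_lt continuous_const hτm).measurableSet.inter
      (isOpen_lt hτm continuous_const).measurableSet
    have hDK : D ∩ K'' ⊆ Ω ∩ K'' := fun x hx => ⟨hsub x hx.2.1 hx.1.1 hx.1.2, hx.2⟩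
    have hin : ∀ x ∈ D, x.1 ∈ K' → x ∈ K'' := by
      intro x hx hx1
      refine ⟨hx1, ?_⟩
      have h1 : |η x.1| ≤ T := hT _ ⟨x.1, hx1, rfl⟩
      have h2 : |x.2 - η x.1| < δ := by
        have := abs_lt.2 ⟨by linarith [hx.1] , hx.2⟩
        rwa [abs_mul, hσ, one_mul] at this
      rw [abs_le] at h1; rw [abs_lt] at h2
      constructor <;> linarith [h1.1, h1.2, h2.1, h2.2]
    -- Split `u ψ - f ψ(graph)` as `(u - f) ψ + f (ψ - ψ(graph))`. The quotient of the first term is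
    -- integrable by `hu`; in the second the difference quotient of `ψ` is bounded by its Lipschitz
    -- constant.
    have key : IntegrableOn (fun x : Horiz n × ℝ =>
        (u x * ψ x * (v.2 - fderiv ℝ η x.1 v.1) - ψ (x.1, η x.1) * f x.1 * κ x.1) /
          (σ * (x.2 - η x.1))) (D ∩ K'') := by
      have hDKm : MeasurableSet (D ∩ K'') := hDm.inter hK''c.measurableSet
      have i1 : IntegrableOn (fun x : Horiz n × ℝ =>
          (u x - f x.1) / (σ * (x.2 - η x.1)) * (ψ x * κ x.1)) (D ∩ K'') := by
        refine Integrable.mul_bdd (c := M * B) ((hu K'' hK''c).mono_set hDK) ?_ ?_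
        · exact (hψcont.measurable.mul (hκm.comp measurable_fst)).aestronglyMeasurable
        · refine Eventually.of_forall fun x => ?_
          rw [norm_mul]
          exact mul_le_mul (hM x) (hκb _) (norm_nonneg _) ((norm_nonneg _).trans (hM x))
      have i2 : IntegrableOn (fun x : Horiz n × ℝ =>
          f x.1 * ((ψ x - ψ (x.1, η x.1)) / (σ * (x.2 - η x.1)) * κ x.1)) (D ∩ K'') := by
        have hfK : IntegrableOn (fun x : Horiz n × ℝ => f x.1) (D ∩ K'') := by
          have : Integrable (fun x : Horiz n × ℝ => f x.1) ((volume.restrict K').prod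
              (volume.restrict (Icc (-(T + δ)) (T + δ)))) :=
            (hf.integrableOn_isCompact hK'c).comp_fst _
          rw [Measure.prod_restrict, ← Measure.volume_eq_prod] at this
          exact IntegrableOn.mono_set (t := K'') this inter_subset_right
        refine Integrable.mul_bdd (c := C * B) hfK ?_ ?_
        · have : Measurable fun x : Horiz n × ℝ =>
              (ψ x - ψ (x.1, η x.1)) / (σ * (x.2 - η x.1)) * κ x.1 :=
            Measurable.mul (Measurable.div (Continuous.measurable (by fun_prop)) hτm.measurable)
              (hκm.comp measurable_fst)
          exact this.aestronglyMeasurable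
        · refine Eventually.of_forall fun x => ?_
          rw [norm_mul]
          refine mul_le_mul ?_ (hκb _) (norm_nonneg _) C.2
          rw [norm_div, norm_mul, Real.norm_eq_abs σ, hσ, one_mul]
          refine div_le_of_le_mul₀ (norm_nonneg _) C.2 ?_
          have := hC.dist_le_mul x (x.1, η x.1)
          rw [dist_eq_norm, dist_eq_norm] at this
          refine this.trans (le_of_eq ?_)
          congr 1
          rw [Prod.norm_def]
          simp
      refine (i1.add i2).congr_fun (fun x hx => ?_) hDKm
      have h0 : σ * (x.2 - η x.1) ≠ 0 := hx.1.1.ne'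
      simp only [Pi.add_apply, hκ]
      field_simp
      ring
    refine IntegrableOn.of_forall_sdiff_eq_zero key hDm fun x hx => ?_
    have hx1 : x.1 ∉ K' := fun h => hx.2 ⟨hx.1, hin x hx.1 h⟩
    rw [hψ0 x hx1, hψ0 (x.1, η x.1) hx1]
    simp

end

noncomputable section

/-! ### The trace of a locally Lipschitz function -/

/-- The ramp that is `0` up to `1` and `1` from `2` on. -/
def ramp (s : ℝ) : ℝ := max 0 (min 1 (s - 1))

theorem ramp_nonneg (s : ℝ) : 0 ≤ ramp s := le_max_left _ _

theorem ramp_le_one (s : ℝ) : ramp s ≤ 1 := max_le zero_le_one (min_le_left _ _)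

theorem ramp_eq_zero {s : ℝ} (h : s ≤ 1) : ramp s = 0 :=
  max_eq_left ((min_le_right _ _).trans (by linarith))

theorem ramp_eq_one {s : ℝ} (h : 2 ≤ s) : ramp s = 1 := by
  rw [ramp, min_eq_left (by linarith), max_eq_right zero_le_one]

theorem continuous_ramp : Continuous ramp := by unfold ramp; fun_prop

theorem lipschitzWith_ramp : LipschitzWith 1 ramp := by
  have h : LipschitzWith 1 fun s : ℝ => s - 1 := LipschitzWith.of_dist_le_mul (by simp)
  exact (h.const_min 1).const_max 0

theorem hasDerivAt_ramp {s : ℝ} (h1 : s ≠ 1) (h2 : s ≠ 2) :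
    HasDerivAt ramp (if 1 < s ∧ s < 2 then 1 else 0) s := by
  rcases lt_or_gt_of_ne h1 with h | h
  · rw [if_neg (fun hs => by linarith [hs.1])]
    refine (hasDerivAt_const s (0 : ℝ)).congr_of_eventuallyEq ?_
    filter_upwards [Iio_mem_nhds h] with t ht using ramp_eq_zero (le_of_lt ht)
  · rcases lt_or_gt_of_ne h2 with h' | h'
    · rw [if_pos ⟨h, h'⟩]
      refine ((hasDerivAt_id s).sub_const 1).congr_of_eventuallyEq ?_
      filter_upwards [Ioo_mem_nhds h h'] with t ht
      rw [ramp, min_eq_right (by linarith [ht.2]), max_eq_right (by linarith [ht.1])]; rfl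
    · rw [if_neg (fun hs => by linarith [hs.2])]
      refine (hasDerivAt_const s (1 : ℝ)).congr_of_eventuallyEq ?_
      filter_upwards [Ioi_mem_nhds h'] with t ht using ramp_eq_one (le_of_lt ht)

/-- Each vertical fibre meets the translated graph in one point. This discards the points where a
ramp in the cutoff has a corner. -/
theorem ae_graph_ne {n : ℕ} {η : Horiz n → ℝ} (hη : Continuous η) (c : ℝ) :
    ∀ᵐ x : Horiz n × ℝ, x.2 - η x.1 ≠ c := by
  have hm : MeasurableSet {x : Horiz n × ℝ | x.2 - η x.1 = c} :=
    (isClosed_eq (by fun_prop) continuous_const).measurableSet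
  have h0 : (volume : Measure (Horiz n × ℝ)) {x : Horiz n × ℝ | x.2 - η x.1 = c} = 0 := by
    rw [Measure.volume_eq_prod, Measure.measure_prod_null hm]
    refine Eventually.of_forall fun x => ?_
    have : Prod.mk x ⁻¹' {x : Horiz n × ℝ | x.2 - η x.1 = c} = {c + η x} := by
      ext s
      simp only [mem_preimage, mem_ofPred_eq, mem_singleton_iff, sub_eq_iff_eq_add]
    simp only [this]; simp
  rw [ae_iff]
  simpa using h0

theorem hasFDerivAt_graph {n : ℕ} {η : Horiz n → ℝ} {x : Horiz n × ℝ}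
    (h : DifferentiableAt ℝ η x.1) :
    HasFDerivAt (fun y : Horiz n × ℝ => y.2 - η y.1)
      (ContinuousLinearMap.snd ℝ (Horiz n) ℝ -
        (fderiv ℝ η x.1).comp (ContinuousLinearMap.fst ℝ (Horiz n) ℝ)) x :=
  hasFDerivAt_snd.sub (HasFDerivAt.comp x h.hasFDerivAt hasFDerivAt_fst)

theorem ae_fst {n : ℕ} {P : Horiz n → Prop} (h : ∀ᵐ x, P x) : ∀ᵐ x : Horiz n × ℝ, P x.1 :=
  Measure.quasiMeasurePreserving_fst.ae h

theorem isOpen_stripDomain {n : ℕ} {ηm ηp : Horiz n → ℝ} (hm : Continuous ηm)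
    (hp : Continuous ηp) : IsOpen (stripDomain ηm ηp) :=
  IsOpen.inter (s := {x : Horiz n × ℝ | ηm x.1 < x.2}) (t := {x : Horiz n × ℝ | x.2 < ηp x.1})
    (isOpen_lt (by fun_prop) (by fun_prop)) (isOpen_lt (by fun_prop) (by fun_prop))

instance isAddHaarMeasure_volume_horiz_prod (n : ℕ) :
    (volume : Measure (Horiz n × ℝ)).IsAddHaarMeasure := by
  rw [Measure.volume_eq_prod]; infer_instance

theorem MemLpLoc.locallyIntegrable {n : ℕ} {p : ℝ} (hp : 1 < p) {f : Horiz n → ℝ}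
    (hf : MemLpLoc p f) : LocallyIntegrable f := by
  rw [locallyIntegrable_iff]
  intro K hK
  have : IsFiniteMeasure (volume.restrict K) := ⟨by simpa using hK.measure_lt_top⟩
  exact (hf K hK).integrable (by simpa using hp.le)

/-- The cutoff that removes the part of the strip with vertical distance at most `ε` from the
boundary. -/
def stripCutoff {n : ℕ} (ηm ηp : Horiz n → ℝ) (ε : ℝ) (x : Horiz n × ℝ) : ℝ :=
  ramp ((x.2 - ηm x.1) / ε) * ramp ((ηp x.1 - x.2) / ε)

/-! ### Regularity, limit and derivative of the cutoff. -/

section Cutoff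

variable {n : ℕ} {ηm ηp : Horiz n → ℝ} {ε : ℝ}

theorem stripCutoff_nonneg (x : Horiz n × ℝ) : 0 ≤ stripCutoff ηm ηp ε x :=
  mul_nonneg (ramp_nonneg _) (ramp_nonneg _)

theorem stripCutoff_le_one (x : Horiz n × ℝ) : stripCutoff ηm ηp ε x ≤ 1 :=
  mul_le_one₀ (ramp_le_one _) (ramp_nonneg _) (ramp_le_one _)

theorem continuous_stripCutoff (hm : Continuous ηm) (hp : Continuous ηp) :
    Continuous (stripCutoff ηm ηp ε) := by
  have := continuous_ramp
  unfold stripCutoff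
  fun_prop

theorem lipNear_graph {Λ : ℝ≥0} {η : Horiz n → ℝ} (h : LipschitzWith Λ η) (x : Horiz n × ℝ) :
    LipNear (fun y : Horiz n × ℝ => y.2 - η y.1) x :=
  LipNear.sub (ContDiffAt.lipNear (by fun_prop)) ((h.comp LipschitzWith.prod_fst).lipNear x)

theorem lipNear_graph' {Λ : ℝ≥0} {η : Horiz n → ℝ} (h : LipschitzWith Λ η) (x : Horiz n × ℝ) :
    LipNear (fun y : Horiz n × ℝ => η y.1 - y.2) x :=
  LipNear.sub ((h.comp LipschitzWith.prod_fst).lipNear x) (ContDiffAt.lipNear (by fun_prop))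

theorem lipNear_stripCutoff {Λm Λp : ℝ≥0} (hm : LipschitzWith Λm ηm) (hp : LipschitzWith Λp ηp)
    (x : Horiz n × ℝ) : LipNear (stripCutoff ηm ηp ε) x := by
  have h : ∀ s : ℝ, LipNear (fun s : ℝ => ramp (s / ε)) s := fun s =>
    LipNear.comp (g := ramp) (lipschitzWith_ramp.lipNear _) (ContDiffAt.lipNear (by fun_prop))
  exact (LipNear.comp (g := fun s : ℝ => ramp (s / ε)) (h _) (lipNear_graph hm x)).mul
    (LipNear.comp (g := fun s : ℝ => ramp (s / ε)) (h _) (lipNear_graph' hp x))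

/-- Outside the strip one of the two vertical distances is at most `0`, hence stays below `ε`
nearby. A product with the cutoff is therefore locally Lipschitz on the whole space, whatever the
other factor does outside the strip. -/
theorem stripCutoff_eventually_zero (hm : Continuous ηm) (hp : Continuous ηp) (hε : 0 < ε)
    {x : Horiz n × ℝ} (hx : x ∉ stripDomain ηm ηp) : stripCutoff ηm ηp ε =ᶠ[𝓝 x] 0 := by
  have : x ∈ {y : Horiz n × ℝ | y.2 - ηm y.1 < ε} ∪ {y : Horiz n × ℝ | ηp y.1 - y.2 < ε} := by
    by_contra h
    simp only [mem_union, mem_ofPred_eq, not_or, not_lt] at h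
    exact hx ⟨by linarith [h.1], by linarith [h.2]⟩
  filter_upwards [((isOpen_lt (by fun_prop) continuous_const).union
    (isOpen_lt (by fun_prop) continuous_const)).mem_nhds this] with y hy
  rcases hy with hy | hy
  · have : ramp ((y.2 - ηm y.1) / ε) = 0 := ramp_eq_zero ((div_le_one hε).2 (le_of_lt hy))
    simp [stripCutoff, this]
  · have : ramp ((ηp y.1 - y.2) / ε) = 0 := ramp_eq_zero ((div_le_one hε).2 (le_of_lt hy))
    simp [stripCutoff, this]

theorem tendsto_stripCutoff {x : Horiz n × ℝ} (hx : x ∈ stripDomain ηm ηp) :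
    Tendsto (fun ε => stripCutoff ηm ηp ε x) (𝓝[>] 0) (𝓝 1) := by
  have h1 : 0 < x.2 - ηm x.1 := by linarith [hx.1]
  have h2 : 0 < ηp x.1 - x.2 := by linarith [hx.2]
  refine tendsto_const_nhds.congr' ?_
  filter_upwards [Ioo_mem_nhdsGT (half_pos h1), Ioo_mem_nhdsGT (half_pos h2)] with ε a1 a2
  rw [stripCutoff, ramp_eq_one, ramp_eq_one, mul_one]
  · rw [le_div_iff₀ a1.1]; linarith [a2.2]
  · rw [le_div_iff₀ a1.1]; linarith [a1.2]

/-- The derivative of the cutoff, where the two boundary layers do not meet. -/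
theorem hasFDerivAt_stripCutoff (hε : 0 < ε) {x : Horiz n × ℝ}
    (hm : DifferentiableAt ℝ ηm x.1) (hp : DifferentiableAt ℝ ηp x.1)
    (m1 : x.2 - ηm x.1 ≠ ε) (m2 : x.2 - ηm x.1 ≠ 2 * ε)
    (p1 : x.2 - ηp x.1 ≠ -ε) (p2 : x.2 - ηp x.1 ≠ -(2 * ε)) :
    ∃ χ' : Horiz n × ℝ →L[ℝ] ℝ, HasFDerivAt (stripCutoff ηm ηp ε) χ' x ∧
      (4 * ε < ηp x.1 - ηm x.1 → ∀ v : Horiz n × ℝ, χ' v =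
        (if ε < x.2 - ηm x.1 ∧ x.2 - ηm x.1 < 2 * ε then
          (v.2 - fderiv ℝ ηm x.1 v.1) / ε else 0) -
        (if ε < ηp x.1 - x.2 ∧ ηp x.1 - x.2 < 2 * ε then
          (v.2 - fderiv ℝ ηp x.1 v.1) / ε else 0)) := by
  have n1 : (x.2 - ηm x.1) / ε ≠ 1 := by rwa [Ne, div_eq_one_iff_eq hε.ne']
  have n2 : (x.2 - ηm x.1) / ε ≠ 2 := by rwa [Ne, div_eq_iff hε.ne']
  have n3 : (ηp x.1 - x.2) / ε ≠ 1 := by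
    rw [Ne, div_eq_one_iff_eq hε.ne']; contrapose! p1; linarith
  have n4 : (ηp x.1 - x.2) / ε ≠ 2 := by
    rw [Ne, div_eq_iff hε.ne']; contrapose! p2; linarith
  have dm := (hasFDerivAt_graph hm).mul_const ε⁻¹
  have dp : HasFDerivAt (fun y : Horiz n × ℝ => (ηp y.1 - y.2) * ε⁻¹) _ x :=
    (HasFDerivAt.sub (HasFDerivAt.comp x hp.hasFDerivAt hasFDerivAt_fst)
      hasFDerivAt_snd).mul_const ε⁻¹
  simp only [← div_eq_mul_inv] at dm dp
  have am := (hasDerivAt_ramp n1 n2).comp_hasFDerivAt x dm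
  have ap := (hasDerivAt_ramp n3 n4).comp_hasFDerivAt x dp
  refine ⟨_, am.mul ap, fun hd v => ?_⟩
  have c1 : (1 < (x.2 - ηm x.1) / ε ∧ (x.2 - ηm x.1) / ε < 2) ↔
      (ε < x.2 - ηm x.1 ∧ x.2 - ηm x.1 < 2 * ε) := by
    rw [one_lt_div hε, div_lt_iff₀ hε]
  have c2 : (1 < (ηp x.1 - x.2) / ε ∧ (ηp x.1 - x.2) / ε < 2) ↔
      (ε < ηp x.1 - x.2 ∧ ηp x.1 - x.2 < 2 * ε) := by
    rw [one_lt_div hε, div_lt_iff₀ hε]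
  simp only [c1, c2, add_apply, smul_apply,
    sub_apply, ContinuousLinearMap.comp_apply, smul_eq_mul,
    ContinuousLinearMap.coe_fst', ContinuousLinearMap.coe_snd', Function.comp_apply]
  -- Since the thickness exceeds `4 * ε`, a point of one layer is at vertical distance more than `2
  -- * ε` from the other graph, so the other ramp equals `1` there and only one layer term is
  -- present.
  by_cases b1 : ε < x.2 - ηm x.1 ∧ x.2 - ηm x.1 < 2 * ε
  · have b2 : ¬ (ε < ηp x.1 - x.2 ∧ ηp x.1 - x.2 < 2 * ε) := fun h => by linarith [h.2, b1.2]
    have r : ramp ((ηp x.1 - x.2) / ε) = 1 :=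
      ramp_eq_one ((le_div_iff₀ hε).2 (by linarith [b1.2]))
    simp only [b1, b2, r, and_self, if_true, if_false]
    ring
  · by_cases b2 : ε < ηp x.1 - x.2 ∧ ηp x.1 - x.2 < 2 * ε
    · have r : ramp ((x.2 - ηm x.1) / ε) = 1 :=
        ramp_eq_one ((le_div_iff₀ hε).2 (by linarith [b2.2]))
      simp only [b1, b2, r, and_self, if_true, if_false]
      ring
    · simp only [b1, b2, if_false]
      ring

end Cutoff

/-- Integration by parts for Lipschitz functions, against the constant `1`. Compact support upgrades
local to global Lipschitz continuity. -/
theorem integral_fderiv_eq_zero {E : Type*} [NormedAddCommGroup E] [NormedSpace ℝ E]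
    [FiniteDimensional ℝ E] [MeasurableSpace E] [BorelSpace E] {μ : Measure E}
    [μ.IsAddHaarMeasure] {g : E → ℝ} (hg : ∀ x, LipNear g x) (hc : HasCompactSupport g) (v : E) :
    ∫ x, fderiv ℝ g x v ∂μ = 0 := by
  obtain ⟨C, hC⟩ := exists_lipschitzWith_of_hasCompactSupport hg hc
  have h := (LipschitzWith.const (1 : ℝ) (α := E)).integral_lineDeriv_mul_eq (μ := μ) hC hc (-v)
  simp only [neg_neg, mul_one] at h
  have h0 : ∀ x : E, lineDeriv ℝ (fun _ : E => (1 : ℝ)) x (-v) = 0 := fun x => by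
    simp [lineDeriv]
  simp only [h0, zero_mul, integral_zero] at h
  rw [h]
  refine integral_congr_ae ?_
  filter_upwards [hC.ae_differentiableAt (μ := μ)] with x hx
  exact hx.lineDeriv_eq_fderiv.symm

/-- A locally Lipschitz function on a strip-like domain has the trace `(fm, fp)`, if its quotients
`(u - fm) / (x_N - ηm)` and `(u - fp) / (ηp - x_N)` are integrable up to the boundary. -/
theorem hasTrace_of_lipNear {n : ℕ} {p : ℝ} (hp : 1 < p) {ηm ηp : Horiz n → ℝ} {Λm Λp : ℝ≥0}
    (hm : LipschitzWith Λm ηm) (hq : LipschitzWith Λp ηp) (hlt : ∀ x, ηm x < ηp x)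
    {u : Horiz n × ℝ → ℝ} {G : Horiz n × ℝ → EVec n} {fm fp : Horiz n → ℝ}
    (hfm : MemLpLoc p fm) (hfp : MemLpLoc p fp) (hu : ∀ x ∈ stripDomain ηm ηp, LipNear u x)
    (hG : ∀ x ∈ stripDomain ηm ηp, ∀ v, inner ℝ (WithLp.toLp 2 v) (G x) = fderiv ℝ u x v)
    (hui : ∀ K : Set (Horiz n × ℝ), IsCompact K → IntegrableOn u (stripDomain ηm ηp ∩ K))
    (hGi : ∀ K : Set (Horiz n × ℝ), IsCompact K → IntegrableOn G (stripDomain ηm ηp ∩ K))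
    (hum : ∀ K : Set (Horiz n × ℝ), IsCompact K →
      IntegrableOn (fun x => (u x - fm x.1) / (x.2 - ηm x.1)) (stripDomain ηm ηp ∩ K))
    (hup : ∀ K : Set (Horiz n × ℝ), IsCompact K →
      IntegrableOn (fun x => (u x - fp x.1) / (ηp x.1 - x.2)) (stripDomain ηm ηp ∩ K)) :
    HasTrace p ηm ηp u G fm fp := by
  refine ⟨hfm, hfp, hui, hGi, ?_⟩
  intro ψ hψ hψc v
  have hmc := hm.continuous
  have hqc := hq.continuous
  set Ω := stripDomain ηm ηp with hΩ
  have hΩo : IsOpen Ω := isOpen_stripDomain hmc hqc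
  have hΩm := hΩo.measurableSet
  set K' : Set (Horiz n) := Prod.fst '' tsupport ψ with hK'
  have hK'c : IsCompact K' := hψc.isCompact.image continuous_fst
  -- The thickness may tend to zero at infinity, but over the compact projection of the support of
  -- `ψ` it has a positive lower bound.
  obtain ⟨δ, hδ, hdδ⟩ := hK'c.exists_forall_le' (f := fun x => ηp x - ηm x) (a := 0)
    (by fun_prop) (fun x _ => by linarith [hlt x])
  have hψd : ∀ x, DifferentiableAt ℝ ψ x := fun x => hψ.differentiable one_ne_zero x
  -- the two boundary layers
  have Lm := tendsto_setIntegral_layer_mul (σ := 1) (by simp) hm (Ω := Ω) (u := u) (f := fm)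
    (hfm.locallyIntegrable hp) (fun K hK => by simpa using hum K hK) hψ hψc hδ (by
      intro x hx h1 h2
      have := hdδ x.1 hx
      exact ⟨by linarith, by linarith⟩) v
  have Lp := tendsto_setIntegral_layer_mul (σ := -1) (by simp) hq (Ω := Ω) (u := u) (f := fp)
    (hfp.locallyIntegrable hp) (fun K hK => by simpa using hup K hK) hψ hψc hδ (by
      intro x hx h1 h2
      have := hdδ x.1 hx
      exact ⟨by linarith, by linarith⟩) v
  simp only [one_mul, neg_mul, neg_sub] at Lm Lp
  -- the interior integrands
  have iU : IntegrableOn (fun x => u x * fderiv ℝ ψ x v) Ω := by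
    have hd : Continuous fun x => fderiv ℝ ψ x v :=
      (hψ.continuous_fderiv one_ne_zero).clm_apply continuous_const
    have h2 : IntegrableOn (fun x => u x * fderiv ℝ ψ x v) (Ω ∩ tsupport ψ) := by
      obtain ⟨M, hM⟩ := hd.bounded_above_of_compact_support (hψc.fderiv_apply (𝕜 := ℝ) v)
      exact Integrable.mul_bdd (c := M) (hui _ hψc.isCompact) hd.aestronglyMeasurable
        (Eventually.of_forall hM)
    refine IntegrableOn.of_forall_sdiff_eq_zero h2 hΩm fun x hx => ?_
    have : x ∉ tsupport ψ := fun h => hx.2 ⟨hx.1, h⟩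
    rw [fderiv_of_notMem_tsupport ℝ this]; simp
  have iG : IntegrableOn (fun x => ψ x * inner ℝ (WithLp.toLp 2 v) (G x)) Ω := by
    have h2 : IntegrableOn (fun x => ψ x * inner ℝ (WithLp.toLp 2 v) (G x))
        (Ω ∩ tsupport ψ) := by
      obtain ⟨M, hM⟩ := hψ.continuous.bounded_above_of_compact_support hψc
      exact Integrable.bdd_mul (c := M) ((hGi _ hψc.isCompact).const_inner _)
        hψ.continuous.aestronglyMeasurable (Eventually.of_forall hM)
    refine IntegrableOn.of_forall_sdiff_eq_zero h2 hΩm fun x hx => ?_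
    have : x ∉ tsupport ψ := fun h => hx.2 ⟨hx.1, h⟩
    rw [image_eq_zero_of_notMem_tsupport this]; simp
  set W : Horiz n × ℝ → ℝ :=
    fun x => u x * fderiv ℝ ψ x v + ψ x * inner ℝ (WithLp.toLp 2 v) (G x) with hW
  have iW : IntegrableOn W Ω := iU.add iG
  set Φm : ℝ → Horiz n × ℝ → ℝ := fun ε x => u x * ψ x * (v.2 - fderiv ℝ ηm x.1 v.1) / ε with hΦm
  set Φp : ℝ → Horiz n × ℝ → ℝ := fun ε x => u x * ψ x * (v.2 - fderiv ℝ ηp x.1 v.1) / ε with hΦp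
  set Sm : ℝ → Set (Horiz n × ℝ) := fun ε => {x | ε < x.2 - ηm x.1 ∧ x.2 - ηm x.1 < 2 * ε} with hSm
  set Sp : ℝ → Set (Horiz n × ℝ) := fun ε => {x | ε < ηp x.1 - x.2 ∧ ηp x.1 - x.2 < 2 * ε} with hSp
  have hSmm : ∀ ε, MeasurableSet (Sm ε) := fun ε =>
    (IsOpen.inter (s := {x : Horiz n × ℝ | ε < x.2 - ηm x.1}) (t := {x : Horiz n × ℝ | x.2 - ηm x.1 < 2 * ε})
      (isOpen_lt (by fun_prop) (by fun_prop)) (isOpen_lt (by fun_prop) (by fun_prop))).measurableSet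
  have hSpm : ∀ ε, MeasurableSet (Sp ε) := fun ε =>
    (IsOpen.inter (s := {x : Horiz n × ℝ | ε < ηp x.1 - x.2}) (t := {x : Horiz n × ℝ | ηp x.1 - x.2 < 2 * ε})
      (isOpen_lt (by fun_prop) (by fun_prop)) (isOpen_lt (by fun_prop) (by fun_prop))).measurableSet
  have hK'0 : ∀ x : Horiz n × ℝ, ψ x ≠ 0 → x.1 ∈ K' := fun x h => ⟨x, subset_tsupport ψ h, rfl⟩
  -- This is `∫ ∂_v (u ψ χ) = 0` for the cutoff `χ`, expanded by the product rule: `W` is `∂_v (u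
  -- ψ)`, and the layer integrals come from `∂_v χ`, with opposite signs at the two graphs.
  have hident : ∀ ε, 0 < ε → 4 * ε < δ → IntegrableOn (Φm ε) (Sm ε) → IntegrableOn (Φp ε) (Sp ε) →
      (∫ x in Ω, stripCutoff ηm ηp ε x * W x) + (∫ x in Sm ε, Φm ε x)
        - (∫ x in Sp ε, Φp ε x) = 0 := by
    intro ε hε hεδ im ip
    set χ := stripCutoff ηm ηp ε with hχ
    set g : Horiz n × ℝ → ℝ := fun x => u x * ψ x * χ x with hg
    have hgzero : ∀ x ∉ Ω, g =ᶠ[𝓝 x] 0 := by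
      intro x hx
      filter_upwards [stripCutoff_eventually_zero hmc hqc hε hx] with y hy
      rw [hg]; simp [hχ, hy]
    have hglip : ∀ x, LipNear g x := by
      intro x
      by_cases hx : x ∈ Ω
      · exact ((hu x hx).mul (ContDiffAt.lipNear hψ.contDiffAt)).mul (lipNear_stripCutoff hm hq x)
      · exact ((LipschitzWith.const (0 : ℝ)).lipNear x).congr (hgzero x hx).symm
    have hgc : HasCompactSupport g := hψc.mono (fun x hx => by
      intro h0
      simp only [hg] at hx
      exact hx (by simp [h0]))
    have hz := integral_fderiv_eq_zero (μ := (volume : Measure (Horiz n × ℝ))) hglip hgc v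
    have i0 : IntegrableOn (fun x => χ x * W x) Ω :=
      Integrable.bdd_mul (c := 1) iW (continuous_stripCutoff hmc hqc).aestronglyMeasurable
        (Eventually.of_forall fun x => by
          rw [Real.norm_of_nonneg (stripCutoff_nonneg x)]; exact stripCutoff_le_one x)
    have j0 := i0.integrable_indicator hΩm
    have jm := im.integrable_indicator (hSmm ε)
    have jp := ip.integrable_indicator (hSpm ε)
    rw [← integral_indicator hΩm, ← integral_indicator (hSmm ε), ← integral_indicator (hSpm ε),
      ← hz, ← integral_add j0 jm]
    refine (integral_sub (j0.add jm) jp).symm.trans (integral_congr_ae ?_)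
    filter_upwards [ae_differentiableAt_of_lipNear (μ := volume) hu,
      ae_fst hm.ae_differentiableAt, ae_fst hq.ae_differentiableAt, ae_graph_ne hmc ε,
      ae_graph_ne hmc (2 * ε), ae_graph_ne hqc (-ε), ae_graph_ne hqc (-(2 * ε))]
      with x xu xm xp m1 m2 p1 p2
    rw [Pi.add_apply]
    by_cases hx : x ∈ Ω
    · obtain ⟨χ', hχ', hχv⟩ := hasFDerivAt_stripCutoff hε xm xp m1 m2 p1 p2
      have hder := (((xu hx).hasFDerivAt.mul (hψd x).hasFDerivAt).mul hχ').fderiv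
      have hder' : fderiv ℝ g x v = u x * ψ x * χ' v + χ x * W x := by
        have := congrArg (fun L => L v) hder
        simp only [add_apply, smul_apply,
          smul_eq_mul] at this
        rw [hW]; simp only
        rw [hG x hx v]
        refine this.trans ?_
        simp only [Pi.mul_apply, hχ]
      rw [hder', indicator_of_mem hx]
      by_cases h0 : ψ x = 0
      · have e1 : Φm ε x = 0 := by simp [hΦm, h0]
        have e2 : Φp ε x = 0 := by simp [hΦp, h0]
        simp [indicator, e1, e2, h0]
      · rw [hχv (by linarith [hdδ x.1 (hK'0 x h0)]) v]
        simp only [indicator, hSm, hSp, hΦm, hΦp, mem_ofPred_eq]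
        split_ifs <;> ring
    · rw [(hgzero x hx).fderiv_eq, indicator_of_notMem hx]
      have e : ∀ S : Set (Horiz n × ℝ), ∀ Φ : Horiz n × ℝ → ℝ, (ψ x ≠ 0 → x ∉ S) →
          (ψ x = 0 → Φ x = 0) → S.indicator Φ x = 0 := by
        intro S Φ h1 h2
        by_cases h0 : ψ x = 0
        · by_cases hS : x ∈ S
          · rw [indicator_of_mem hS, h2 h0]
          · exact indicator_of_notMem hS _
        · exact indicator_of_notMem (h1 h0) _
      rw [e (Sm ε) (Φm ε) (fun h0 hS => hx ⟨by linarith [hS.1], by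
          linarith [hS.2, hdδ x.1 (hK'0 x h0)]⟩) (fun h0 => by simp [hΦm, h0]),
        e (Sp ε) (Φp ε) (fun h0 hS => hx ⟨by linarith [hS.2, hdδ x.1 (hK'0 x h0)], by
          linarith [hS.1]⟩) (fun h0 => by simp [hΦp, h0])]
      simp
  have hlimW : Tendsto (fun ε => ∫ x in Ω, stripCutoff ηm ηp ε x * W x) (𝓝[>] 0)
      (𝓝 (∫ x in Ω, W x)) := by
    refine tendsto_integral_filter_of_dominated_convergence (fun x => ‖W x‖)
      (Eventually.of_forall fun ε =>
        (continuous_stripCutoff hmc hqc).aestronglyMeasurable.mul iW.aestronglyMeasurable)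
      (Eventually.of_forall fun ε => Eventually.of_forall fun x => ?_) iW.norm ?_
    · rw [norm_mul, Real.norm_of_nonneg (stripCutoff_nonneg x)]
      exact mul_le_of_le_one_left (norm_nonneg _) (stripCutoff_le_one x)
    · filter_upwards [ae_restrict_mem hΩm] with x hx
      simpa using (tendsto_stripCutoff hx).mul_const (W x)
  have hlim := (hlimW.add Lm.2).sub Lp.2
  have hzero := tendsto_nhds_unique hlim (tendsto_const_nhds.congr' (by
    have : Ioo (0 : ℝ) (δ / 4) ∈ 𝓝[>] (0 : ℝ) := Ioo_mem_nhdsGT (by positivity)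
    filter_upwards [this, Lm.1, Lp.1] with ε hε h1 h2
    exact (hident ε hε.1 (by linarith [hε.2]) h1 h2).symm))
  have hWsum : ∫ x in Ω, W x = (∫ x in Ω, u x * fderiv ℝ ψ x v) +
      ∫ x in Ω, ψ x * inner ℝ (WithLp.toLp 2 v) (G x) := integral_add iU iG
  rw [hWsum] at hzero
  linarith

/-- The integration by parts formula that defines the trace contains the one that defines the weak
gradient. -/
theorem HasTrace.isWeakGradient {n : ℕ} {p : ℝ} {ηm ηp : Horiz n → ℝ} (hm : Continuous ηm)
    (hq : Continuous ηp) {u : Horiz n × ℝ → ℝ} {G : Horiz n × ℝ → EVec n} {fm fp : Horiz n → ℝ}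
    (h : HasTrace p ηm ηp u G fm fp) : IsWeakGradient (stripDomain ηm ηp) u G := by
  obtain ⟨-, -, hu, hG, hI⟩ := h
  have hΩo := isOpen_stripDomain hm hq
  refine ⟨?_, ?_, ?_⟩
  · rw [locallyIntegrableOn_iff hΩo.isLocallyClosed]
    intro K hK hKc
    exact (hu K hKc).mono_set (subset_inter hK le_rfl)
  · rw [locallyIntegrableOn_iff hΩo.isLocallyClosed]
    intro K hK hKc
    exact (hG K hKc).mono_set (subset_inter hK le_rfl)
  · intro φ hφ hc hs v
    have h0 : ∀ x ∉ stripDomain ηm ηp, φ x = 0 := fun x hx =>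
      image_eq_zero_of_notMem_tsupport fun h => hx (hs h)
    rw [hI φ (hφ.of_le (by exact_mod_cast le_top)) hc v]
    have e1 : ∀ x, φ (x, ηp x) = 0 := fun x => h0 _ fun h => lt_irrefl _ h.2
    have e2 : ∀ x, φ (x, ηm x) = 0 := fun x => h0 _ fun h => lt_irrefl _ h.1
    simp [e1, e2]

end

noncomputable section

/-! ### Energy of the oscillation quotient -/

/-- The oscillation of `f` on the ball of radius `a τ` around `y`, relative to `(a τ / 2)^(n+1)`. -/
def oscQuot {n : ℕ} (a : ℝ) (f : Horiz n → ℝ) (z : Horiz n × ℝ) : ℝ :=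
  ballOsc f (a * z.2) z.1 / (a / 2 * z.2) ^ (n + 1)

theorem oscQuot_nonneg {n : ℕ} {a : ℝ} (ha : 0 < a) (f : Horiz n → ℝ) {z : Horiz n × ℝ}
    (hz : 0 < z.2) : 0 ≤ oscQuot a f z :=
  div_nonneg (ballOsc_nonneg _ _ _) (by positivity)

/-- Joint measurability in centre and radius: the ball integral is a parametric integral of an
indicator on the product space. -/
theorem measurable_oscQuot {n : ℕ} (a : ℝ) {f : Horiz n → ℝ} (hf : Measurable f) :
    Measurable (oscQuot a f) := by
  have hS : MeasurableSet {q : (Horiz n × ℝ) × Horiz n | dist q.2 q.1.1 < a * q.1.2} :=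
    (isOpen_lt (by fun_prop) (by fun_prop)).measurableSet
  have hm : StronglyMeasurable ({q : (Horiz n × ℝ) × Horiz n | dist q.2 q.1.1 < a * q.1.2}.indicator
      fun q => |f q.2 - f q.1.1|) := by
    refine (Measurable.indicator ?_ hS).stronglyMeasurable
    have : Measurable fun q : (Horiz n × ℝ) × Horiz n => f q.2 - f q.1.1 := by fun_prop
    exact this.norm
  have h2 : Measurable fun z : Horiz n × ℝ => ballOsc f (a * z.2) z.1 := by
    have := (hm.integral_prod_right' (ν := (volume : Measure (Horiz n)))).measurable
    convert this using 2 with z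
    rw [ballOsc, ← integral_indicator Metric.isOpen_ball.measurableSet]
    rfl
  exact h2.div (by fun_prop)

theorem lintegral_rpow_le_measure_rpow_mul {α : Type*} [MeasurableSpace α] {μ : Measure α}
    {p : ℝ} (hp : 1 < p) {g : α → ℝ≥0∞} (hg : AEMeasurable g μ) :
    (∫⁻ x, g x ∂μ) ^ p ≤ μ univ ^ (p - 1) * ∫⁻ x, g x ^ p ∂μ := by
  have hpq : p.HolderConjugate (p / (p - 1)) := Real.HolderConjugate.conjExponent hp
  have h := ENNReal.lintegral_mul_le_Lp_mul_Lq μ hpq hg (aemeasurable_const (b := (1 : ℝ≥0∞)))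
  have hp0 : 0 < p := by linarith
  simp only [Pi.mul_apply, mul_one, ENNReal.one_rpow, lintegral_const, one_mul] at h
  calc (∫⁻ x, g x ∂μ) ^ p
      ≤ ((∫⁻ x, g x ^ p ∂μ) ^ (1 / p) * μ univ ^ (1 / (p / (p - 1)))) ^ p := by gcongr
    _ = _ := by
      rw [ENNReal.mul_rpow_of_nonneg _ _ hp0.le, ← ENNReal.rpow_mul, ← ENNReal.rpow_mul,
        one_div_mul_cancel hp0.ne', ENNReal.rpow_one, mul_comm]
      congr 2
      have : p - 1 ≠ 0 := by linarith
      field_simp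

/-- The constant in the pointwise Hölder estimate of the oscillation quotient. -/
def oscConst (n : ℕ) (a p : ℝ) : ℝ :=
  (volume.real (Metric.ball (0 : Horiz n) 1)) ^ (p - 1) * a ^ (n * (p - 1)) *
    (a / 2) ^ (-((n + 1) * p))

theorem oscConst_nonneg (n : ℕ) {a p : ℝ} (ha : 0 < a) : 0 ≤ oscConst n a p := by
  unfold oscConst; positivity

/-- Hölder's inequality on a ball of volume proportional to `(a τ) ^ n`. -/
theorem ofReal_oscQuot_rpow_le {n : ℕ} {a p : ℝ} (ha : 0 < a) (hp : 1 < p) {f : Horiz n → ℝ}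
    (hf : Measurable f) (hfi : LocallyIntegrable f) (y : Horiz n) {τ : ℝ} (hτ : 0 < τ) :
    ENNReal.ofReal (oscQuot a f (y, τ)) ^ p ≤
      ENNReal.ofReal (oscConst n a p * τ ^ (-(p + n))) *
        ∫⁻ h in Metric.ball (0 : Horiz n) (a * τ), ‖f (y + h) - f y‖ₑ ^ p := by
  have hp0 : 0 < p := by linarith
  have hosc : ENNReal.ofReal (ballOsc f (a * τ) y) =
      ∫⁻ h in Metric.ball (0 : Horiz n) (a * τ), ‖f (y + h) - f y‖ₑ := by
    have hi : IntegrableOn (fun z => f z - f y) (Metric.ball y (a * τ)) :=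
      integrableOn_ball_of_locallyIntegrable (hfi.sub (locallyIntegrable_const _)) _ _
    have h1 : ENNReal.ofReal (ballOsc f (a * τ) y) =
        ∫⁻ z in Metric.ball y (a * τ), ‖f z - f y‖ₑ := by
      rw [ballOsc]
      exact ofReal_integral_norm_eq_lintegral_enorm hi
    rw [h1, ← lintegral_indicator Metric.isOpen_ball.measurableSet,
      ← lintegral_indicator Metric.isOpen_ball.measurableSet,
      ← lintegral_add_left_eq_self _ y]
    refine lintegral_congr fun h => ?_
    simp only [indicator, Metric.mem_ball, dist_self_add_left, dist_zero_right]
  have hvol : volume (Metric.ball (0 : Horiz n) (a * τ)) =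
      ENNReal.ofReal ((a * τ) ^ n * volume.real (Metric.ball (0 : Horiz n) 1)) := by
    rw [Measure.addHaar_ball_of_pos _ _ (by positivity : 0 < a * τ), finrank_euclideanSpace,
      Fintype.card_fin, ENNReal.ofReal_mul (by positivity), ofReal_measureReal
        Metric.isBounded_ball.measure_lt_top.ne]
  have hH := lintegral_rpow_le_measure_rpow_mul (μ := volume.restrict (Metric.ball (0 : Horiz n)
    (a * τ))) hp (g := fun h => ‖f (y + h) - f y‖ₑ) (by fun_prop)
  rw [← hosc, Measure.restrict_apply_univ, hvol] at hH
  have hd : (0 : ℝ) < (a / 2 * τ) ^ (n + 1) := by positivity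
  rw [oscQuot, ENNReal.ofReal_div_of_pos hd, ENNReal.div_rpow_of_nonneg _ _ hp0.le]
  refine (ENNReal.div_le_div_right hH _).trans (le_of_eq ?_)
  rw [mul_comm, mul_div_assoc, mul_comm]
  congr 1
  have hV : 0 ≤ volume.real (Metric.ball (0 : Horiz n) 1) := measureReal_nonneg
  rw [ENNReal.ofReal_rpow_of_nonneg (by positivity) (by linarith),
    ENNReal.ofReal_rpow_of_pos hd, ← ENNReal.ofReal_div_of_pos (by positivity)]
  congr 1
  rw [oscConst, Real.mul_rpow (by positivity) hV, ← Real.rpow_natCast, ← Real.rpow_natCast,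
    ← Real.rpow_mul (by positivity), ← Real.rpow_mul (by positivity),
    Real.mul_rpow ha.le hτ.le, Real.mul_rpow (by positivity) hτ.le, div_eq_mul_inv, mul_inv,
    ← Real.rpow_neg (by positivity), ← Real.rpow_neg hτ.le]
  -- Exponent count: `n (p - 1)` from the volume of the ball and `-(n + 1) p` from the
  -- normalization.
  have : τ ^ (-(p + n)) = τ ^ ((n : ℝ) * (p - 1)) * τ ^ (-(((n + 1 : ℕ) : ℝ) * p)) := by
    rw [← Real.rpow_add hτ]; congr 1; push_cast; ring
  rw [this]
  push_cast
  ring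

theorem lintegral_Ioi_rpow_neg {q c : ℝ} (hq : 1 < q) (hc : 0 < c) :
    ∫⁻ τ in Ioi c, ENNReal.ofReal (τ ^ (-q)) = ENNReal.ofReal (c ^ (1 - q) / (q - 1)) := by
  rw [← ofReal_integral_eq_lintegral_ofReal (integrableOn_Ioi_rpow_of_lt (by linarith) hc),
    integral_Ioi_rpow_of_lt (by linarith) hc]
  · congr 1
    rw [show -q + 1 = -(q - 1) by ring, div_neg, neg_div, neg_neg]
    congr 2; ring
  · filter_upwards [ae_restrict_mem measurableSet_Ioi] with τ hτ
    exact Real.rpow_nonneg (hc.trans hτ).le _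

/-- The constant in the energy estimate of the oscillation quotient. -/
def oscEnergyConst (n : ℕ) (a p : ℝ) : ℝ :=
  oscConst n a p * (a ^ (p + n - 1) / (p + n - 1))

/-- Apply the Hölder bound and exchange the integrals. An increment `h` is seen only by `τ > ‖h‖ /
a`, and integrating `τ ^ (-(p + n))` over that range produces `‖h‖ ^ (-(p + n - 1))`, the weight of
the screened seminorm of order `1 - 1 / p`. -/
theorem lintegral_oscQuot_rpow_le {n : ℕ} {a p : ℝ} (ha : 0 < a) (hp : 1 < p) {f : Horiz n → ℝ}
    (hf : Measurable f) (hfi : LocallyIntegrable f) (y : Horiz n) (d : ℝ) :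
    ∫⁻ τ in Ioo 0 d, ENNReal.ofReal (oscQuot a f (y, τ)) ^ p ≤
      ENNReal.ofReal (oscEnergyConst n a p) *
        ∫⁻ h in Metric.ball (0 : Horiz n) (a * d),
          ‖f (y + h) - f y‖ₑ ^ p / ‖h‖ₑ ^ ((1 - 1 / p) * p + n) := by
  have hp0 : 0 < p := by linarith
  have hn0 : (0 : ℝ) ≤ n := Nat.cast_nonneg n
  set k : ℝ → ℝ≥0∞ := fun τ => ENNReal.ofReal (oscConst n a p * τ ^ (-(p + n))) with hk
  have hkm : Measurable k := by
    have : Measurable fun τ : ℝ => oscConst n a p * τ ^ (-(p + n)) := by fun_prop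
    exact this.ennreal_ofReal
  set g : Horiz n → ℝ≥0∞ := fun h => ‖f (y + h) - f y‖ₑ ^ p with hg
  have hgm : Measurable g := by
    have : Measurable fun h => ‖f (y + h) - f y‖ₑ := by fun_prop
    exact this.pow_const p
  have hSm : MeasurableSet {q : ℝ × Horiz n | ‖q.2‖ < a * q.1} :=
    (isOpen_lt (by fun_prop) (by fun_prop)).measurableSet
  calc ∫⁻ τ in Ioo 0 d, ENNReal.ofReal (oscQuot a f (y, τ)) ^ p
      ≤ ∫⁻ τ in Ioo 0 d, ∫⁻ h, {q : ℝ × Horiz n | ‖q.2‖ < a * q.1}.indicator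
          (fun q => k q.1 * g q.2) (τ, h) := by
        refine setLIntegral_mono' measurableSet_Ioo fun τ hτ => ?_
        refine (ofReal_oscQuot_rpow_le ha hp hf hfi y hτ.1).trans (le_of_eq ?_)
        rw [← lintegral_const_mul _ hgm, ← lintegral_indicator Metric.isOpen_ball.measurableSet]
        refine lintegral_congr fun h => ?_
        simp only [indicator, Metric.mem_ball, dist_zero_right, mem_ofPred_eq, hk, hg]
    _ = ∫⁻ h, ∫⁻ τ in Ioo 0 d, {q : ℝ × Horiz n | ‖q.2‖ < a * q.1}.indicator
          (fun q => k q.1 * g q.2) (τ, h) := by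
        refine lintegral_lintegral_swap ?_
        exact (((hkm.comp measurable_fst).mul (hgm.comp measurable_snd)).indicator hSm).aemeasurable
    _ ≤ ∫⁻ h, (Metric.ball (0 : Horiz n) (a * d)).indicator (fun h =>
          ENNReal.ofReal (oscEnergyConst n a p) *
            (‖f (y + h) - f y‖ₑ ^ p / ‖h‖ₑ ^ ((1 - 1 / p) * p + n))) h := by
        refine lintegral_mono fun h => ?_
        rcases eq_or_ne h 0 with rfl | h0
        · have hz : g 0 = 0 := by simp [hg, hp0]
          simp [indicator, hz]
        have hh : 0 < ‖h‖ := norm_pos_iff.2 h0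
        by_cases hb : h ∈ Metric.ball (0 : Horiz n) (a * d)
        · rw [indicator_of_mem hb]
          -- The upper limit `d` is given up here; integrating to infinity still converges because
          -- `p + n > 1`.
          have hle : ∀ τ : ℝ, {q : ℝ × Horiz n | ‖q.2‖ < a * q.1}.indicator
              (fun q => k q.1 * g q.2) (τ, h) ≤
              (Ioi (‖h‖ / a)).indicator (fun τ => (ENNReal.ofReal (oscConst n a p) * g h) *
                ENNReal.ofReal (τ ^ (-(p + n)))) τ := by
            intro τ
            by_cases hτ : ‖h‖ < a * τ
            · have hτ' : τ ∈ Ioi (‖h‖ / a) := by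
                rw [mem_Ioi, div_lt_iff₀ ha, mul_comm]; exact hτ
              rw [indicator_of_mem hτ', indicator_of_mem (show (τ, h) ∈ {q : ℝ × Horiz n |
                ‖q.2‖ < a * q.1} from hτ), hk]
              simp only
              rw [ENNReal.ofReal_mul (oscConst_nonneg n ha)]
              exact le_of_eq (by ring)
            · rw [indicator_of_notMem (show (τ, h) ∉ {q : ℝ × Horiz n |
                ‖q.2‖ < a * q.1} from hτ)]
              exact zero_le
          refine ((lintegral_mono hle).trans (setLIntegral_le_lintegral _ _)).trans (le_of_eq ?_)
          rw [lintegral_indicator measurableSet_Ioi, lintegral_const_mul' _ _ (by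
              refine ENNReal.mul_ne_top ENNReal.ofReal_ne_top ?_
              exact ENNReal.rpow_ne_top_of_nonneg hp0.le enorm_ne_top),
            lintegral_Ioi_rpow_neg (by linarith) (by positivity), oscEnergyConst]
          have he : (1 - 1 / p) * p + n = p + n - 1 := by field_simp; ring
          rw [he, ← ofReal_norm h, ENNReal.ofReal_rpow_of_pos hh,
            div_eq_mul_inv (‖f (y + h) - f y‖ₑ ^ p), ← ENNReal.ofReal_inv_of_pos (by positivity)]
          rw [ENNReal.ofReal_mul (oscConst_nonneg n ha)]
          have e1 : (‖h‖ / a) ^ (1 - (p + n)) / (p + n - 1) =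
              a ^ (p + n - 1) / (p + n - 1) * (‖h‖ ^ (p + n - 1))⁻¹ := by
            rw [show 1 - (p + n) = -(p + n - 1) by ring, Real.rpow_neg (by positivity),
              Real.div_rpow hh.le ha.le, inv_div]
            ring
          rw [e1, ENNReal.ofReal_mul (by
            have : 0 < p + n - 1 := by linarith
            positivity)]
          ring
        · rw [indicator_of_notMem hb]
          rw [mem_ball_zero_iff, not_lt] at hb
          -- The screening: an increment with `‖h‖ ≥ a * d` lies in no ball of radius `a * τ` with
          -- `τ < d`.
          refine le_of_eq (setLIntegral_eq_zero measurableSet_Ioo fun τ hτ => ?_)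
          refine indicator_of_notMem ?_ _
          intro hlt
          have : a * τ < a * d := mul_lt_mul_of_pos_left hτ.2 ha
          exact absurd (hb.trans_lt (show ‖h‖ < a * τ from hlt)) (by linarith)
    _ = _ := by
        rw [lintegral_indicator Metric.isOpen_ball.measurableSet,
          lintegral_const_mul' _ _ ENNReal.ofReal_ne_top]

/-! ### Integrals over a strip-like domain -/

variable {n : ℕ} {ηm ηp : Horiz n → ℝ}

/-- Tonelli and a vertical translation of each fibre, which straightens the lower graph. The upper
graph is treated by a reflection instead. -/
theorem lintegral_stripDomain_lower (hm : Continuous ηm) (hq : Continuous ηp)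
    {F : Horiz n × ℝ → ℝ≥0∞} (hF : Measurable F) :
    ∫⁻ x in stripDomain ηm ηp, F (x.1, x.2 - ηm x.1) =
      ∫⁻ y, ∫⁻ τ in Ioo 0 (ηp y - ηm y), F (y, τ) := by
  have hΩ := (isOpen_stripDomain hm hq).measurableSet
  have hFm : Measurable fun x : Horiz n × ℝ => F (x.1, x.2 - ηm x.1) :=
    hF.comp (Continuous.measurable (by fun_prop))
  rw [← lintegral_indicator hΩ, Measure.volume_eq_prod, lintegral_prod _
    (hFm.indicator hΩ).aemeasurable]
  refine lintegral_congr fun y => ?_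
  rw [← lintegral_indicator measurableSet_Ioo, ← lintegral_sub_right_eq_self
    ((Ioo 0 (ηp y - ηm y)).indicator fun τ => F (y, τ)) (ηm y)]
  refine lintegral_congr fun s => ?_
  have : (y, s) ∈ stripDomain ηm ηp ↔ s - ηm y ∈ Ioo 0 (ηp y - ηm y) := by
    simp [stripDomain]
  simp only [indicator, this]

theorem lintegral_stripDomain_upper (hm : Continuous ηm) (hq : Continuous ηp)
    {F : Horiz n × ℝ → ℝ≥0∞} (hF : Measurable F) :
    ∫⁻ x in stripDomain ηm ηp, F (x.1, ηp x.1 - x.2) =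
      ∫⁻ y, ∫⁻ τ in Ioo 0 (ηp y - ηm y), F (y, τ) := by
  have hΩ := (isOpen_stripDomain hm hq).measurableSet
  have hFm : Measurable fun x : Horiz n × ℝ => F (x.1, ηp x.1 - x.2) :=
    hF.comp (Continuous.measurable (by fun_prop))
  rw [← lintegral_indicator hΩ, Measure.volume_eq_prod, lintegral_prod _
    (hFm.indicator hΩ).aemeasurable]
  refine lintegral_congr fun y => ?_
  rw [← lintegral_indicator measurableSet_Ioo, ← lintegral_sub_left_eq_self
    ((Ioo 0 (ηp y - ηm y)).indicator fun τ => F (y, τ)) (ηp y)]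
  refine lintegral_congr fun s => ?_
  have : (y, s) ∈ stripDomain ηm ηp ↔ ηp y - s ∈ Ioo 0 (ηp y - ηm y) := by
    simp [stripDomain, and_comm]
  simp only [indicator, this]

theorem lintegral_oscQuot_lower_le (hm : Continuous ηm) (hq : Continuous ηp) {a p : ℝ}
    (ha : 0 < a) (hp : 1 < p) {f : Horiz n → ℝ} (hf : Measurable f) (hfi : LocallyIntegrable f) :
    ∫⁻ x in stripDomain ηm ηp, ENNReal.ofReal (oscQuot a f (x.1, x.2 - ηm x.1)) ^ p ≤
      ENNReal.ofReal (oscEnergyConst n a p) *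
        screenedEnergy (1 - 1 / p) p (stripScreen a ηm ηp) f := by
  rw [lintegral_stripDomain_lower hm hq (F := fun z => ENNReal.ofReal (oscQuot a f z) ^ p)
    ((measurable_oscQuot a hf).ennreal_ofReal.pow_const p), screenedEnergy,
    ← lintegral_const_mul' _ _ ENNReal.ofReal_ne_top]
  exact lintegral_mono fun y => lintegral_oscQuot_rpow_le ha hp hf hfi y _

theorem lintegral_oscQuot_upper_le (hm : Continuous ηm) (hq : Continuous ηp) {a p : ℝ}
    (ha : 0 < a) (hp : 1 < p) {f : Horiz n → ℝ} (hf : Measurable f) (hfi : LocallyIntegrable f) :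
    ∫⁻ x in stripDomain ηm ηp, ENNReal.ofReal (oscQuot a f (x.1, ηp x.1 - x.2)) ^ p ≤
      ENNReal.ofReal (oscEnergyConst n a p) *
        screenedEnergy (1 - 1 / p) p (stripScreen a ηm ηp) f := by
  rw [lintegral_stripDomain_upper hm hq (F := fun z => ENNReal.ofReal (oscQuot a f z) ^ p)
    ((measurable_oscQuot a hf).ennreal_ofReal.pow_const p), screenedEnergy,
    ← lintegral_const_mul' _ _ ENNReal.ofReal_ne_top]
  exact lintegral_mono fun y => lintegral_oscQuot_rpow_le ha hp hf hfi y _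

/-- The integrand is constant on a fibre, whose length `d` cancels one of the `p` factors `1 / d`.
-/
theorem lintegral_stripDomain_diffQuot (hm : Continuous ηm) (hq : Continuous ηp)
    (hlt : ∀ x, ηm x < ηp x) {p : ℝ} (hp : 1 < p) {fm fp : Horiz n → ℝ} (hfm : Measurable fm)
    (hfp : Measurable fp) :
    ∫⁻ x in stripDomain ηm ηp, ENNReal.ofReal (|fp x.1 - fm x.1| / (ηp x.1 - ηm x.1)) ^ p =
      weightedDiff p ηm ηp fm fp := by
  have hF : Measurable fun z : Horiz n × ℝ =>
      ENNReal.ofReal (|fp z.1 - fm z.1| / (ηp z.1 - ηm z.1)) ^ p := by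
    have h1 : Measurable fun z : Horiz n × ℝ => |fp z.1 - fm z.1| :=
      ((hfp.comp measurable_fst).sub (hfm.comp measurable_fst)).norm
    have h2 : Measurable fun z : Horiz n × ℝ => ηp z.1 - ηm z.1 :=
      Continuous.measurable (by fun_prop)
    exact (h1.div h2).ennreal_ofReal.pow_const p
  rw [lintegral_stripDomain_lower hm hq hF, weightedDiff]
  refine lintegral_congr fun y => ?_
  have hd : 0 < ηp y - ηm y := by linarith [hlt y]
  simp only
  rw [setLIntegral_const, Real.volume_Ioo, sub_zero, ← ofReal_norm, Real.norm_eq_abs,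
    ENNReal.ofReal_rpow_of_nonneg (by positivity) (by linarith),
    ENNReal.ofReal_rpow_of_nonneg (by positivity) (by linarith),
    ← ENNReal.ofReal_mul (by positivity), ← ENNReal.ofReal_div_of_pos (by positivity)]
  congr 1
  rw [Real.div_rpow (by positivity) hd.le, Real.rpow_sub_one hd.ne']
  field_simp

end

noncomputable section

/-! ### The extension operator -/

section Extension

variable {n : ℕ}

/-- The averaging radius associated with the lower graph. -/
def lowerRadius (a : ℝ) (η : Horiz n → ℝ) (x : Horiz n × ℝ) : ℝ := a / 2 * (x.2 - η x.1)

/-- The averaging radius associated with the upper graph. -/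
def upperRadius (a : ℝ) (η : Horiz n → ℝ) (x : Horiz n × ℝ) : ℝ := a / 2 * (η x.1 - x.2)

/-- The relative height of a point of the strip between the two graphs. -/
def stripHeight (ηm ηp : Horiz n → ℝ) (x : Horiz n × ℝ) : ℝ :=
  (x.2 - ηm x.1) / (ηp x.1 - ηm x.1)

/-- The extension of a pair of boundary functions to the strip: it interpolates between averages
of the two functions at the scale of the distance to the respective graph. -/
def stripExt (a : ℝ) (ηm ηp : Horiz n → ℝ) (f : (Horiz n → ℝ) × (Horiz n → ℝ))
    (x : Horiz n × ℝ) : ℝ :=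
  tentAvg (lowerRadius a ηm) f.1 x + stripHeight ηm ηp x *
    (tentAvg (upperRadius a ηp) f.2 x - tentAvg (lowerRadius a ηm) f.1 x)

/-- The function that controls the gradient and the boundary quotients of the extension. -/
def stripMajorant (a : ℝ) (ηm ηp : Horiz n → ℝ) (fm fp : Horiz n → ℝ) (x : Horiz n × ℝ) : ℝ :=
  |fp x.1 - fm x.1| / (ηp x.1 - ηm x.1) + oscQuot a fm (x.1, x.2 - ηm x.1) +
    oscQuot a fp (x.1, ηp x.1 - x.2)

/-- The slack `Λ ≤ L` allows both radii to share the constant given by the sum of the two Lipschitz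
constants. -/
theorem lipschitzWith_smul_graph {c : ℝ} (hc : |c| ≤ 1) {η : Horiz n → ℝ} {Λ L : ℝ≥0}
    (hη : LipschitzWith Λ η) (hL : Λ ≤ L) :
    LipschitzWith (1 + L) fun x : Horiz n × ℝ => c * (x.2 - η x.1) := by
  refine LipschitzWith.of_dist_le_mul fun x y => ?_
  have h1 := hη.dist_le_mul x.1 y.1
  rw [Real.dist_eq, dist_eq_norm] at h1 ⊢
  have h2 : ‖x.1 - y.1‖ ≤ ‖x - y‖ := norm_fst_le (x - y)
  have h3 : |x.2 - y.2| ≤ ‖x - y‖ := norm_snd_le (x - y)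
  have hL' : (Λ : ℝ) ≤ L := hL
  have h4 : (Λ : ℝ) * ‖x.1 - y.1‖ ≤ L * ‖x - y‖ :=
    mul_le_mul hL' h2 (norm_nonneg _) L.2
  rw [← mul_sub, abs_mul]
  calc |c| * |x.2 - η x.1 - (y.2 - η y.1)| ≤ 1 * |x.2 - η x.1 - (y.2 - η y.1)| := by gcongr
    _ = |(x.2 - y.2) - (η x.1 - η y.1)| := by rw [one_mul]; ring_nf
    _ ≤ |x.2 - y.2| + |η x.1 - η y.1| := abs_sub _ _
    _ ≤ _ := by push_cast; linarith

section Radius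

variable {a : ℝ} {η : Horiz n → ℝ} {Λ L : ℝ≥0}

theorem lipschitzWith_lowerRadius (ha : 0 < a) (ha1 : a < 1) (hη : LipschitzWith Λ η)
    (hL : Λ ≤ L) : LipschitzWith (1 + L) (lowerRadius a η) :=
  lipschitzWith_smul_graph (by rw [abs_of_pos (by positivity)]; linarith) hη hL

theorem lipschitzWith_upperRadius (ha : 0 < a) (ha1 : a < 1) (hη : LipschitzWith Λ η)
    (hL : Λ ≤ L) : LipschitzWith (1 + L) (upperRadius a η) := by
  have h := lipschitzWith_smul_graph (c := -(a / 2))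
    (by rw [abs_neg, abs_of_pos (by positivity)]; linarith) hη hL
  convert h using 2 with x
  rw [upperRadius]; ring

theorem differentiableAt_lowerRadius {x : Horiz n × ℝ} (h : DifferentiableAt ℝ η x.1) :
    DifferentiableAt ℝ (lowerRadius a η) x :=
  (hasFDerivAt_graph h).differentiableAt.const_mul _

theorem differentiableAt_upperRadius {x : Horiz n × ℝ} (h : DifferentiableAt ℝ η x.1) :
    DifferentiableAt ℝ (upperRadius a η) x := by
  have e : upperRadius a η = fun y => -(a / 2) * (y.2 - η y.1) := by
    funext y; rw [upperRadius]; ring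
  rw [e]
  exact (hasFDerivAt_graph h).differentiableAt.const_mul _

end Radius

theorem stripExt_add {a : ℝ} {ηm ηp : Horiz n → ℝ} {f g : (Horiz n → ℝ) × (Horiz n → ℝ)}
    (hf1 : LocallyIntegrable f.1) (hf2 : LocallyIntegrable f.2) (hg1 : LocallyIntegrable g.1)
    (hg2 : LocallyIntegrable g.2) :
    stripExt a ηm ηp (f + g) = stripExt a ηm ηp f + stripExt a ηm ηp g := by
  funext x
  simp only [stripExt, Prod.fst_add, Prod.snd_add, tentAvg_add hf1 hg1, tentAvg_add hf2 hg2,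
    Pi.add_apply]
  ring

theorem stripExt_smul {a : ℝ} {ηm ηp : Horiz n → ℝ} (c : ℝ)
    (f : (Horiz n → ℝ) × (Horiz n → ℝ)) :
    stripExt a ηm ηp (c • f) = c • stripExt a ηm ηp f := by
  funext x
  simp only [stripExt, Prod.smul_fst, Prod.smul_snd, tentAvg_smul, Pi.smul_apply, smul_eq_mul]
  ring

theorem stripExt_congr_ae {a : ℝ} {ηm ηp : Horiz n → ℝ} {f g : (Horiz n → ℝ) × (Horiz n → ℝ)}
    (h1 : f.1 =ᵐ[volume] g.1) (h2 : f.2 =ᵐ[volume] g.2) :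
    stripExt a ηm ηp f = stripExt a ηm ηp g := by
  funext x
  rw [stripExt, stripExt, tentAvg_congr_ae h1, tentAvg_congr_ae h2]

/-- The constant in the pointwise estimates of the extension. -/
def extPointConst (n : ℕ) : ℝ := 2 + (4 * n + 10) / tentMass n

theorem extPointConst_pos (n : ℕ) : 0 < extPointConst n := by
  have := tentMass_pos n
  unfold extPointConst; positivity

/-! ### Pointwise estimates -/

section Pointwise

variable {a : ℝ} {ηm ηp : Horiz n → ℝ} {fm fp : Horiz n → ℝ} {x : Horiz n × ℝ}

theorem stripMajorant_nonneg (ha : 0 < a) (hx : x ∈ stripDomain ηm ηp) :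
    0 ≤ stripMajorant a ηm ηp fm fp x := by
  have h1 : 0 < x.2 - ηm x.1 := by linarith [hx.1]
  have h2 : 0 < ηp x.1 - x.2 := by linarith [hx.2]
  have h3 : 0 < ηp x.1 - ηm x.1 := by linarith
  exact add_nonneg (add_nonneg (by positivity) (oscQuot_nonneg ha _ h1)) (oscQuot_nonneg ha _ h2)

/-- The radius is `a / 2` times the height, so twice the radius is the radius `a τ` in `oscQuot`; `a
< 1` bounds the prefactor by the height. -/
theorem abs_tentAvg_lower_sub_le (ha : 0 < a) (ha1 : a < 1) (hfm : LocallyIntegrable fm)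
    (hx : x ∈ stripDomain ηm ηp) :
    |tentAvg (lowerRadius a ηm) fm x - fm x.1| ≤
      (x.2 - ηm x.1) * (oscQuot a fm (x.1, x.2 - ηm x.1) / tentMass n) := by
  have h1 : 0 < x.2 - ηm x.1 := by linarith [hx.1]
  have hρ : 0 < lowerRadius a ηm x := by unfold lowerRadius; positivity
  have h := abs_tentAvg_sub_le hfm hρ
  have e : ballOsc fm (2 * lowerRadius a ηm x) x.1 / lowerRadius a ηm x ^ (n + 1) =
      oscQuot a fm (x.1, x.2 - ηm x.1) := by
    rw [oscQuot, lowerRadius]; congr 2; ring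
  rw [e, mul_div_assoc] at h
  refine h.trans (mul_le_mul_of_nonneg_right ?_
    (div_nonneg (oscQuot_nonneg ha _ h1) (tentMass_pos n).le))
  unfold lowerRadius; nlinarith

theorem abs_tentAvg_upper_sub_le (ha : 0 < a) (ha1 : a < 1) (hfp : LocallyIntegrable fp)
    (hx : x ∈ stripDomain ηm ηp) :
    |tentAvg (upperRadius a ηp) fp x - fp x.1| ≤
      (ηp x.1 - x.2) * (oscQuot a fp (x.1, ηp x.1 - x.2) / tentMass n) := by
  have h1 : 0 < ηp x.1 - x.2 := by linarith [hx.2]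
  have hρ : 0 < upperRadius a ηp x := by unfold upperRadius; positivity
  have h := abs_tentAvg_sub_le hfp hρ
  have e : ballOsc fp (2 * upperRadius a ηp x) x.1 / upperRadius a ηp x ^ (n + 1) =
      oscQuot a fp (x.1, ηp x.1 - x.2) := by
    rw [oscQuot, upperRadius]; congr 2; ring
  rw [e, mul_div_assoc] at h
  refine h.trans (mul_le_mul_of_nonneg_right ?_
    (div_nonneg (oscQuot_nonneg ha _ h1) (tentMass_pos n).le))
  unfold upperRadius; nlinarith

/-- Pass from one average to the other through `fp x'` and `fm x'`; both vertical distances are at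
most the thickness. The factor `ηp - ηm` will cancel the denominator in the derivative of the
relative height. -/
theorem abs_tentAvg_upper_sub_lower_le (ha : 0 < a) (ha1 : a < 1) (hfm : LocallyIntegrable fm)
    (hfp : LocallyIntegrable fp) (hx : x ∈ stripDomain ηm ηp) :
    |tentAvg (upperRadius a ηp) fp x - tentAvg (lowerRadius a ηm) fm x| ≤
      (ηp x.1 - ηm x.1) * ((1 + 1 / tentMass n) * stripMajorant a ηm ηp fm fp x) := by
  have hm := tentMass_pos n
  have h1 : 0 < x.2 - ηm x.1 := by linarith [hx.1]
  have h2 : 0 < ηp x.1 - x.2 := by linarith [hx.2]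
  have h3 : 0 < ηp x.1 - ηm x.1 := by linarith
  have A := abs_tentAvg_lower_sub_le ha ha1 hfm hx
  have B := abs_tentAvg_upper_sub_le ha ha1 hfp hx
  set D := |fp x.1 - fm x.1| / (ηp x.1 - ηm x.1) with hD
  have hD0 : 0 ≤ D := by positivity
  have hDe : |fp x.1 - fm x.1| = (ηp x.1 - ηm x.1) * D := by rw [hD]; field_simp
  have M0 := oscQuot_nonneg ha fm (z := (x.1, x.2 - ηm x.1)) h1
  have P0 := oscQuot_nonneg ha fp (z := (x.1, ηp x.1 - x.2)) h2
  rw [stripMajorant, ← hD]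
  set M := oscQuot a fm (x.1, x.2 - ηm x.1)
  set P := oscQuot a fp (x.1, ηp x.1 - x.2)
  set F := tentAvg (lowerRadius a ηm) fm x
  set F' := tentAvg (upperRadius a ηp) fp x
  have hM : 0 ≤ M / tentMass n := by positivity
  have hP : 0 ≤ P / tentMass n := by positivity
  calc |F' - F| = |(F' - fp x.1) + (fp x.1 - fm x.1) - (F - fm x.1)| := by ring_nf
    _ ≤ |F' - fp x.1| + |fp x.1 - fm x.1| + |F - fm x.1| :=
        (abs_sub _ _).trans (add_le_add_left (abs_add_le _ _) _)
    _ ≤ (ηp x.1 - x.2) * (P / tentMass n) + (ηp x.1 - ηm x.1) * D +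
          (x.2 - ηm x.1) * (M / tentMass n) := by rw [hDe]; gcongr
    _ ≤ (ηp x.1 - ηm x.1) * (P / tentMass n) + (ηp x.1 - ηm x.1) * D +
          (ηp x.1 - ηm x.1) * (M / tentMass n) := by gcongr <;> linarith
    _ = (ηp x.1 - ηm x.1) * (D + M / tentMass n + P / tentMass n) := by ring
    _ ≤ _ := by
        refine mul_le_mul_of_nonneg_left ?_ h3.le
        have : (1 + 1 / tentMass n) * (D + M + P) = (D + M / tentMass n + P / tentMass n) +
            (D / tentMass n + M + P) := by ring
        rw [this]
        have : 0 ≤ D / tentMass n := by positivity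
        linarith

theorem oscQuot_lower_le_stripMajorant (ha : 0 < a) (hx : x ∈ stripDomain ηm ηp) :
    oscQuot a fm (x.1, x.2 - ηm x.1) ≤ stripMajorant a ηm ηp fm fp x := by
  have h2 : 0 < ηp x.1 - x.2 := by linarith [hx.2]
  have h3 : 0 < ηp x.1 - ηm x.1 := by linarith [hx.1]
  have P0 := oscQuot_nonneg ha fp (z := (x.1, ηp x.1 - x.2)) h2
  have : 0 ≤ |fp x.1 - fm x.1| / (ηp x.1 - ηm x.1) := by positivity
  unfold stripMajorant; linarith

theorem oscQuot_upper_le_stripMajorant (ha : 0 < a) (hx : x ∈ stripDomain ηm ηp) :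
    oscQuot a fp (x.1, ηp x.1 - x.2) ≤ stripMajorant a ηm ηp fm fp x := by
  have h1 : 0 < x.2 - ηm x.1 := by linarith [hx.1]
  have h3 : 0 < ηp x.1 - ηm x.1 := by linarith [hx.2]
  have P0 := oscQuot_nonneg ha fm (z := (x.1, x.2 - ηm x.1)) h1
  have : 0 ≤ |fp x.1 - fm x.1| / (ηp x.1 - ηm x.1) := by positivity
  unfold stripMajorant; linarith

/-- In `u - fm = (F - fm) + t (F' - F)` both terms carry the height as a factor: the first by the
estimate for averages, the second through `t`. At the upper graph `1 - t` takes the role of `t`. -/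
theorem abs_stripExt_sub_lower_le (ha : 0 < a) (ha1 : a < 1) (hfm : LocallyIntegrable fm)
    (hfp : LocallyIntegrable fp) (hx : x ∈ stripDomain ηm ηp) :
    |(stripExt a ηm ηp (fm, fp) x - fm x.1) / (x.2 - ηm x.1)| ≤
      extPointConst n * stripMajorant a ηm ηp fm fp x := by
  have hm := tentMass_pos n
  have h1 : 0 < x.2 - ηm x.1 := by linarith [hx.1]
  have h3 : 0 < ηp x.1 - ηm x.1 := by linarith [hx.2]
  have A := abs_tentAvg_lower_sub_le ha ha1 hfm hx
  have B := abs_tentAvg_upper_sub_lower_le ha ha1 hfm hfp hx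
  have hM := oscQuot_lower_le_stripMajorant (fm := fm) (fp := fp) ha hx
  have hQ := stripMajorant_nonneg (fm := fm) (fp := fp) ha hx
  rw [abs_div, abs_of_pos h1, div_le_iff₀ h1]
  set Q := stripMajorant a ηm ηp fm fp x
  set F := tentAvg (lowerRadius a ηm) fm x with hF
  set F' := tentAvg (upperRadius a ηp) fp x with hF'
  have e : stripExt a ηm ηp (fm, fp) x - fm x.1 =
      (F - fm x.1) + (x.2 - ηm x.1) / (ηp x.1 - ηm x.1) * (F' - F) := by
    simp only [stripExt, stripHeight, ← hF, ← hF']; ring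
  rw [e]
  calc _ ≤ |F - fm x.1| + |(x.2 - ηm x.1) / (ηp x.1 - ηm x.1) * (F' - F)| := abs_add_le _ _
    _ ≤ (x.2 - ηm x.1) * (Q / tentMass n) + (x.2 - ηm x.1) / (ηp x.1 - ηm x.1) *
          ((ηp x.1 - ηm x.1) * ((1 + 1 / tentMass n) * Q)) := by
        rw [abs_mul, abs_of_pos (div_pos h1 h3)]
        refine add_le_add (A.trans ?_) ?_ <;> gcongr
    _ = (1 + 2 / tentMass n) * Q * (x.2 - ηm x.1) := by field_simp; ring
    _ ≤ _ := by
        refine mul_le_mul_of_nonneg_right (mul_le_mul_of_nonneg_right ?_ hQ) h1.le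
        unfold extPointConst
        have : (0 : ℝ) ≤ n := Nat.cast_nonneg n
        gcongr
        · norm_num
        · linarith

theorem abs_stripExt_sub_upper_le (ha : 0 < a) (ha1 : a < 1) (hfm : LocallyIntegrable fm)
    (hfp : LocallyIntegrable fp) (hx : x ∈ stripDomain ηm ηp) :
    |(stripExt a ηm ηp (fm, fp) x - fp x.1) / (ηp x.1 - x.2)| ≤
      extPointConst n * stripMajorant a ηm ηp fm fp x := by
  have hm := tentMass_pos n
  have h1 : 0 < ηp x.1 - x.2 := by linarith [hx.2]
  have h3 : 0 < ηp x.1 - ηm x.1 := by linarith [hx.1]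
  have A := abs_tentAvg_upper_sub_le ha ha1 hfp hx
  have B := abs_tentAvg_upper_sub_lower_le ha ha1 hfm hfp hx
  have hM := oscQuot_upper_le_stripMajorant (fm := fm) (fp := fp) ha hx
  have hQ := stripMajorant_nonneg (fm := fm) (fp := fp) ha hx
  rw [abs_div, abs_of_pos h1, div_le_iff₀ h1]
  set Q := stripMajorant a ηm ηp fm fp x
  set F := tentAvg (lowerRadius a ηm) fm x with hF
  set F' := tentAvg (upperRadius a ηp) fp x with hF'
  have e : stripExt a ηm ηp (fm, fp) x - fp x.1 =
      (F' - fp x.1) - (ηp x.1 - x.2) / (ηp x.1 - ηm x.1) * (F' - F) := by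
    simp only [stripExt, stripHeight, ← hF, ← hF']; field_simp; ring
  rw [e]
  calc _ ≤ |F' - fp x.1| + |(ηp x.1 - x.2) / (ηp x.1 - ηm x.1) * (F' - F)| := abs_sub _ _
    _ ≤ (ηp x.1 - x.2) * (Q / tentMass n) + (ηp x.1 - x.2) / (ηp x.1 - ηm x.1) *
          ((ηp x.1 - ηm x.1) * ((1 + 1 / tentMass n) * Q)) := by
        rw [abs_mul, abs_of_pos (div_pos h1 h3)]
        refine add_le_add (A.trans ?_) ?_ <;> gcongr
    _ = (1 + 2 / tentMass n) * Q * (ηp x.1 - x.2) := by field_simp; ring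
    _ ≤ _ := by
        refine mul_le_mul_of_nonneg_right (mul_le_mul_of_nonneg_right ?_ hQ) h1.le
        unfold extPointConst
        have : (0 : ℝ) ≤ n := Nat.cast_nonneg n
        gcongr
        · norm_num
        · linarith

variable {Λm Λp : ℝ≥0}

theorem lipNear_stripHeight (hm : LipschitzWith Λm ηm) (hq : LipschitzWith Λp ηp)
    (hx : x ∈ stripDomain ηm ηp) : LipNear (stripHeight ηm ηp) x :=
  (lipNear_graph hm x).div (LipNear.sub ((hq.comp LipschitzWith.prod_fst).lipNear x)
    ((hm.comp LipschitzWith.prod_fst).lipNear x)) (by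
      have h1 := hx.1; have h2 := hx.2
      have : 0 < ηp x.1 - ηm x.1 := by linarith
      exact this.ne')

theorem lipNear_stripExt (ha : 0 < a) (ha1 : a < 1) (hm : LipschitzWith Λm ηm)
    (hq : LipschitzWith Λp ηp) (hfm : LocallyIntegrable fm) (hfp : LocallyIntegrable fp)
    (hx : x ∈ stripDomain ηm ηp) : LipNear (stripExt a ηm ηp (fm, fp)) x := by
  have h1 : 0 < x.2 - ηm x.1 := by linarith [hx.1]
  have h2 : 0 < ηp x.1 - x.2 := by linarith [hx.2]
  have l1 := lipNear_tentAvg hfm (lipschitzWith_lowerRadius ha ha1 hm le_rfl) (x := x)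
    (by unfold lowerRadius; positivity)
  have l2 := lipNear_tentAvg hfp (lipschitzWith_upperRadius ha ha1 hq le_rfl) (x := x)
    (by unfold upperRadius; positivity)
  exact l1.add ((lipNear_stripHeight hm hq hx).mul (l2.sub l1))

/-- Differentiate the identity `t d = τ` instead of the quotient. With `L` the sum of the two
Lipschitz constants, `|t| ≤ 1`, `‖τ'‖ ≤ 1 + L` and `‖d'‖ ≤ L` give `d ‖t'‖ ≤ 1 + 2 L`. -/
theorem differentiableAt_stripHeight_and_norm_fderiv_le (hm : LipschitzWith Λm ηm) (hq : LipschitzWith Λp ηp)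
    (hx : x ∈ stripDomain ηm ηp) (hdm : DifferentiableAt ℝ ηm x.1)
    (hdp : DifferentiableAt ℝ ηp x.1) :
    DifferentiableAt ℝ (stripHeight ηm ηp) x ∧
    ‖fderiv ℝ (stripHeight ηm ηp) x‖ ≤ 2 * (1 + (Λm + Λp : ℝ≥0)) / (ηp x.1 - ηm x.1) := by
  have h1 : 0 < x.2 - ηm x.1 := by linarith [hx.1]
  have h2 : 0 < ηp x.1 - x.2 := by linarith [hx.2]
  have hd : 0 < ηp x.1 - ηm x.1 := by linarith
  have dτ := (hasFDerivAt_graph hdm (x := x)).differentiableAt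
  have dd : DifferentiableAt ℝ (fun y : Horiz n × ℝ => ηp y.1 - ηm y.1) x :=
    (hdp.comp x differentiableAt_fst).sub (hdm.comp x differentiableAt_fst)
  have ht : DifferentiableAt ℝ (stripHeight ηm ηp) x :=
    dτ.fun_mul (dd.fun_inv hd.ne')
  refine ⟨ht, ?_⟩
  have hev : (fun y : Horiz n × ℝ => y.2 - ηm y.1) =ᶠ[𝓝 x]
      fun y => stripHeight ηm ηp y * (ηp y.1 - ηm y.1) := by
    have hc : Continuous fun y : Horiz n × ℝ => ηp y.1 - ηm y.1 := by
      have := hm.continuous; have := hq.continuous; fun_prop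
    filter_upwards [(isOpen_lt continuous_const hc).mem_nhds hd] with y hy
    rw [stripHeight, div_mul_cancel₀ _ (ne_of_gt hy)]
  have hprod := (ht.hasFDerivAt.mul dd.hasFDerivAt).congr_of_eventuallyEq hev
  have n1 : ‖fderiv ℝ (fun y : Horiz n × ℝ => y.2 - ηm y.1) x‖ ≤ 1 + (Λm + Λp : ℝ≥0) := by
    have := lipschitzWith_smul_graph (c := 1) (by simp) hm (L := Λm + Λp) le_self_add
    simp only [one_mul] at this
    simpa using norm_fderiv_le_of_lipschitz ℝ this (x₀ := x)
  have n2 : ‖fderiv ℝ (fun y : Horiz n × ℝ => ηp y.1 - ηm y.1) x‖ ≤ (Λm + Λp : ℝ≥0) := by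
    have := (hq.comp (LipschitzWith.prod_fst (α := Horiz n) (β := ℝ))).sub
      (hm.comp (LipschitzWith.prod_fst (α := Horiz n) (β := ℝ)))
    have h := norm_fderiv_le_of_lipschitz ℝ this (x₀ := x)
    rw [mul_one, mul_one, add_comm] at h
    exact h
  have n3 : |stripHeight ηm ηp x| ≤ 1 := by
    rw [stripHeight, abs_of_pos (div_pos h1 hd), div_le_one hd]; linarith
  rw [hprod.fderiv] at n1
  set t' := fderiv ℝ (stripHeight ηm ηp) x
  set d' := fderiv ℝ (fun y : Horiz n × ℝ => ηp y.1 - ηm y.1) x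
  have : (ηp x.1 - ηm x.1) • t' = (stripHeight ηm ηp x • d' + (ηp x.1 - ηm x.1) • t') -
      stripHeight ηm ηp x • d' := by abel
  have hn : ‖(ηp x.1 - ηm x.1) • t'‖ ≤ (1 + (Λm + Λp : ℝ≥0)) + (Λm + Λp : ℝ≥0) := by
    rw [this]
    refine (norm_sub_le _ _).trans (add_le_add n1 ?_)
    rw [norm_smul, Real.norm_eq_abs]
    exact (mul_le_of_le_one_left (norm_nonneg _) n3).trans n2
  rw [norm_smul, Real.norm_of_nonneg hd.le, mul_comm, ← le_div_iff₀ hd] at hn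
  refine hn.trans (div_le_div_of_nonneg_right ?_ hd.le)
  linarith

/-- The gradient is `(1 - t) ∇F + t ∇F' + (F' - F) ∇t`. Oscillation quotients bound the first two
terms; in the third the thickness cancels. Each term costs only one factor `1 + L`. -/
theorem ae_norm_fderiv_stripExt_le (ha : 0 < a) (ha1 : a < 1) (hm : LipschitzWith Λm ηm)
    (hq : LipschitzWith Λp ηp) (hfm : LocallyIntegrable fm) (hfp : LocallyIntegrable fp) :
    ∀ᵐ x : Horiz n × ℝ, x ∈ stripDomain ηm ηp → ‖fderiv ℝ (stripExt a ηm ηp (fm, fp)) x‖ ≤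
      extPointConst n * (1 + (Λm + Λp : ℝ≥0)) * stripMajorant a ηm ηp fm fp x := by
  have Lm := lipschitzWith_lowerRadius ha ha1 hm (L := Λm + Λp) le_self_add
  have Lp := lipschitzWith_upperRadius ha ha1 hq (L := Λm + Λp) le_add_self
  have rm : ∀ x ∈ stripDomain ηm ηp, 0 < lowerRadius a ηm x := fun x hx => by
    have h1 : 0 < x.2 - ηm x.1 := by linarith [hx.1]
    unfold lowerRadius; positivity
  have rp : ∀ x ∈ stripDomain ηm ηp, 0 < upperRadius a ηp x := fun x hx => by
    have h1 : 0 < ηp x.1 - x.2 := by linarith [hx.2]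
    unfold upperRadius; positivity
  filter_upwards [ae_fst hm.ae_differentiableAt, ae_fst hq.ae_differentiableAt,
    ae_differentiableAt_of_lipNear (μ := volume) (Ω := stripDomain ηm ηp)
      fun x hx => lipNear_tentAvg hfm Lm (rm x hx),
    ae_differentiableAt_of_lipNear (μ := volume) (Ω := stripDomain ηm ηp)
      fun x hx => lipNear_tentAvg hfp Lp (rp x hx)] with x dm dp dFm dFp hx
  have hmass := tentMass_pos n
  have h1 : 0 < x.2 - ηm x.1 := by linarith [hx.1]
  have h2 : 0 < ηp x.1 - x.2 := by linarith [hx.2]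
  have hd : 0 < ηp x.1 - ηm x.1 := by linarith
  obtain ⟨dt, nt⟩ := differentiableAt_stripHeight_and_norm_fderiv_le hm hq hx dm dp
  have nm := norm_fderiv_tentAvg_le hfm Lm (rm x hx) (differentiableAt_lowerRadius dm) (dFm hx)
  have np := norm_fderiv_tentAvg_le hfp Lp (rp x hx) (differentiableAt_upperRadius dp) (dFp hx)
  have e1 : ballOsc fm (2 * lowerRadius a ηm x) x.1 / lowerRadius a ηm x ^ (n + 1) =
      oscQuot a fm (x.1, x.2 - ηm x.1) := by
    rw [oscQuot, lowerRadius]; congr 2; ring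
  have e2 : ballOsc fp (2 * upperRadius a ηp x) x.1 / upperRadius a ηp x ^ (n + 1) =
      oscQuot a fp (x.1, ηp x.1 - x.2) := by
    rw [oscQuot, upperRadius]; congr 2; ring
  rw [e1] at nm
  rw [e2] at np
  have B := abs_tentAvg_upper_sub_lower_le ha ha1 hfm hfp hx
  have hM := oscQuot_lower_le_stripMajorant (fm := fm) (fp := fp) ha hx
  have hP := oscQuot_upper_le_stripMajorant (fm := fm) (fp := fp) ha hx
  have hQ := stripMajorant_nonneg (fm := fm) (fp := fp) ha hx
  have n3 : |stripHeight ηm ηp x| ≤ 1 := by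
    rw [stripHeight, abs_of_pos (div_pos h1 hd), div_le_one hd]; linarith
  set Q := stripMajorant a ηm ηp fm fp x
  set M := oscQuot a fm (x.1, x.2 - ηm x.1)
  set P := oscQuot a fp (x.1, ηp x.1 - x.2)
  have hder : fderiv ℝ (stripExt a ηm ηp (fm, fp)) x = _ :=
    ((dFm hx).hasFDerivAt.add (dt.hasFDerivAt.mul
      ((dFp hx).hasFDerivAt.sub (dFm hx).hasFDerivAt))).fderiv
  rw [hder]
  set F := tentAvg (lowerRadius a ηm) fm
  set F' := tentAvg (upperRadius a ηp) fp
  set t := stripHeight ηm ηp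
  set L : ℝ := ((Λm + Λp : ℝ≥0) : ℝ) with hL
  have hL0 : 0 ≤ L := (Λm + Λp : ℝ≥0).2
  have hn0 : (0 : ℝ) ≤ n := Nat.cast_nonneg n
  set k : ℝ := 1 / tentMass n with hk
  have hk0 : 0 < k := by positivity
  -- The radii have Lipschitz constant `1 + L`, so the gradient bound for averages brings `2 + L ≤ 2
  -- (1 + L)`.
  have hcoef : ((n + 2) * (1 + ((1 + (Λm + Λp) : ℝ≥0) : ℝ)) / tentMass n) ≤
      2 * (n + 2) * (1 + L) * k := by
    rw [div_eq_mul_one_div, ← hk]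
    refine mul_le_mul_of_nonneg_right ?_ hk0.le
    rw [NNReal.coe_add, NNReal.coe_one, ← hL]
    nlinarith
  have bm : ‖fderiv ℝ F x‖ ≤ 2 * (n + 2) * (1 + L) * k * Q :=
    nm.trans (mul_le_mul hcoef hM (oscQuot_nonneg ha _ h1) (by positivity))
  have bp : ‖fderiv ℝ F' x‖ ≤ 2 * (n + 2) * (1 + L) * k * Q :=
    np.trans (mul_le_mul hcoef hP (oscQuot_nonneg ha _ h2) (by positivity))
  have bt : ‖(F' x - F x) • fderiv ℝ t x‖ ≤ 2 * (1 + L) * (1 + k) * Q := by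
    rw [norm_smul, Real.norm_eq_abs]
    calc |F' x - F x| * ‖fderiv ℝ t x‖
        ≤ ((ηp x.1 - ηm x.1) * ((1 + k) * Q)) * (2 * (1 + L) / (ηp x.1 - ηm x.1)) := by gcongr
      _ = _ := by field_simp
  have bd : ‖t x • (fderiv ℝ F' x - fderiv ℝ F x) + fderiv ℝ F x‖ ≤
      2 * (2 * (n + 2) * (1 + L) * k * Q) := by
    have t0 : 0 ≤ t x := div_nonneg h1.le hd.le
    have t1 : t x ≤ 1 := (le_abs_self _).trans n3
    have : t x • (fderiv ℝ F' x - fderiv ℝ F x) + fderiv ℝ F x =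
        t x • fderiv ℝ F' x + (1 - t x) • fderiv ℝ F x := by module
    rw [this]
    refine (norm_add_le _ _).trans ?_
    rw [norm_smul, norm_smul, Real.norm_of_nonneg t0, Real.norm_of_nonneg (by linarith)]
    have i1 := mul_le_of_le_one_left (norm_nonneg (fderiv ℝ F' x)) t1
    have i2 := mul_le_of_le_one_left (norm_nonneg (fderiv ℝ F x)) (by linarith : 1 - t x ≤ 1)
    linarith
  calc ‖fderiv ℝ F x + (t x • (fderiv ℝ F' x - fderiv ℝ F x) + (F' x - F x) • fderiv ℝ t x)‖
      = ‖(t x • (fderiv ℝ F' x - fderiv ℝ F x) + fderiv ℝ F x) +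
          (F' x - F x) • fderiv ℝ t x‖ := by congr 1; abel
    _ ≤ 2 * (2 * (n + 2) * (1 + L) * k * Q) + 2 * (1 + L) * (1 + k) * Q :=
        (norm_add_le _ _).trans (add_le_add bd bt)
    -- Adding `4 (n + 2) k` and `2 (1 + k)` with `k = 1 / tentMass n` gives the value of
    -- `extPointConst`.
    _ = extPointConst n * (1 + L) * Q := by
        rw [extPointConst, div_eq_mul_one_div, ← hk]; ring

end Pointwise

end Extension

end

noncomputable section

section Assembly

variable {n : ℕ}

/-! ### The gradient as a vector field -/

/-- The Euclidean gradient of a function on `ℝⁿ × ℝ`. -/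
def euclGradient (u : Horiz n × ℝ → ℝ) (x : Horiz n × ℝ) : EVec n :=
  (InnerProductSpace.toDual ℝ (EVec n)).symm ((fderiv ℝ u x).comp
    (WithLp.prodContinuousLinearEquiv 2 ℝ (Horiz n) ℝ : EVec n →L[ℝ] Horiz n × ℝ))

theorem inner_euclGradient (u : Horiz n × ℝ → ℝ) (x v : Horiz n × ℝ) :
    inner ℝ (WithLp.toLp 2 v) (euclGradient u x) = fderiv ℝ u x v := by
  rw [real_inner_comm, euclGradient, InnerProductSpace.toDual_symm_apply]
  rfl

/-- The product carries the max norm, which the Euclidean norm dominates, so the dual norm can only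
decrease. -/
theorem norm_euclGradient_le (u : Horiz n × ℝ → ℝ) (x : Horiz n × ℝ) :
    ‖euclGradient u x‖ ≤ ‖fderiv ℝ u x‖ := by
  rw [euclGradient, LinearIsometryEquiv.norm_map]
  refine ContinuousLinearMap.opNorm_le_bound _ (norm_nonneg _) fun w => ?_
  refine ((fderiv ℝ u x).le_opNorm _).trans (mul_le_mul_of_nonneg_left ?_ (norm_nonneg _))
  exact max_le (WithLp.norm_fst_le _ w) (WithLp.norm_snd_le _ w)

theorem stronglyMeasurable_euclGradient (u : Horiz n × ℝ → ℝ) :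
    StronglyMeasurable (euclGradient u) := by
  have h1 : StronglyMeasurable (fderiv ℝ u) := (measurable_fderiv ℝ u).stronglyMeasurable
  have h2 : Continuous fun A : Horiz n × ℝ →L[ℝ] ℝ =>
      (InnerProductSpace.toDual ℝ (EVec n)).symm (A.comp
        (WithLp.prodContinuousLinearEquiv 2 ℝ (Horiz n) ℝ : EVec n →L[ℝ] Horiz n × ℝ)) := by
    fun_prop
  exact h2.comp_stronglyMeasurable h1

/-! ### Integral estimates for the majorant -/

theorem measurable_stripMajorant (a : ℝ) {ηm ηp fm fp : Horiz n → ℝ} (hm : Continuous ηm)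
    (hq : Continuous ηp) (hfm : Measurable fm) (hfp : Measurable fp) :
    Measurable (stripMajorant a ηm ηp fm fp) := by
  have h1 : Measurable fun x : Horiz n × ℝ => |fp x.1 - fm x.1| :=
    ((hfp.comp measurable_fst).sub (hfm.comp measurable_fst)).norm
  have h2 : Measurable fun x : Horiz n × ℝ => ηp x.1 - ηm x.1 :=
    Continuous.measurable (by fun_prop)
  exact ((h1.div h2).add ((measurable_oscQuot a hfm).comp (Continuous.measurable (by fun_prop)))).add
    ((measurable_oscQuot a hfp).comp (Continuous.measurable (by fun_prop)))

theorem add_add_rpow_le {p : ℝ} (hp : 1 < p) (x y z : ℝ≥0∞) :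
    (x + y + z) ^ p ≤ 3 ^ p * (x ^ p + y ^ p + z ^ p) := by
  have hp0 : 0 ≤ p := by linarith
  have h : ∀ m : ℝ≥0∞, x ≤ m → y ≤ m → z ≤ m → (x + y + z) ^ p ≤ 3 ^ p * m ^ p := by
    intro m hx hy hz
    rw [← ENNReal.mul_rpow_of_nonneg _ _ hp0]
    refine ENNReal.rpow_le_rpow ?_ hp0
    calc x + y + z ≤ m + m + m := by gcongr
      _ = 3 * m := by ring
  rcases le_total x y with h1 | h1
  · rcases le_total y z with h2 | h2
    · exact (h z (h1.trans h2) h2 le_rfl).trans (by gcongr; exact le_add_self)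
    · refine (h y h1 le_rfl h2).trans ?_
      gcongr
      exact le_add_self.trans le_self_add
  · rcases le_total x z with h2 | h2
    · exact (h z h2 (h1.trans h2) le_rfl).trans (by gcongr; exact le_add_self)
    · refine (h x le_rfl h1 h2).trans ?_
      gcongr
      exact le_self_add.trans le_self_add

theorem lintegral_stripMajorant_rpow_le {a p : ℝ} (ha : 0 < a) (hp : 1 < p)
    {ηm ηp fm fp : Horiz n → ℝ} (hm : Continuous ηm) (hq : Continuous ηp)
    (hlt : ∀ x, ηm x < ηp x) (hfm : Measurable fm) (hfp : Measurable fp)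
    (hfmi : LocallyIntegrable fm) (hfpi : LocallyIntegrable fp) :
    ∫⁻ x in stripDomain ηm ηp, ENNReal.ofReal (stripMajorant a ηm ηp fm fp x) ^ p ≤
      3 ^ p * (weightedDiff p ηm ηp fm fp +
        ENNReal.ofReal (oscEnergyConst n a p) *
          screenedEnergy (1 - 1 / p) p (stripScreen a ηm ηp) fm +
        ENNReal.ofReal (oscEnergyConst n a p) *
          screenedEnergy (1 - 1 / p) p (stripScreen a ηm ηp) fp) := by
  have h3 : (3 : ℝ≥0∞) ^ p ≠ ⊤ := ENNReal.rpow_ne_top_of_nonneg (by linarith) (by simp)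
  have m1 : Measurable fun x : Horiz n × ℝ =>
      ENNReal.ofReal (oscQuot a fm (x.1, x.2 - ηm x.1)) ^ p :=
    ((measurable_oscQuot a hfm).comp
      (Continuous.measurable (by fun_prop))).ennreal_ofReal.pow_const p
  have m2 : Measurable fun x : Horiz n × ℝ =>
      ENNReal.ofReal (oscQuot a fp (x.1, ηp x.1 - x.2)) ^ p :=
    ((measurable_oscQuot a hfp).comp
      (Continuous.measurable (by fun_prop))).ennreal_ofReal.pow_const p
  calc ∫⁻ x in stripDomain ηm ηp, ENNReal.ofReal (stripMajorant a ηm ηp fm fp x) ^ p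
      ≤ ∫⁻ x in stripDomain ηm ηp, 3 ^ p *
          (ENNReal.ofReal (|fp x.1 - fm x.1| / (ηp x.1 - ηm x.1)) ^ p +
            ENNReal.ofReal (oscQuot a fm (x.1, x.2 - ηm x.1)) ^ p +
            ENNReal.ofReal (oscQuot a fp (x.1, ηp x.1 - x.2)) ^ p) := by
        refine lintegral_mono fun x => ?_
        refine le_trans (ENNReal.rpow_le_rpow ?_ (by linarith)) (add_add_rpow_le hp _ _ _)
        exact ENNReal.ofReal_add_le.trans (by gcongr; exact ENNReal.ofReal_add_le)
    _ ≤ _ := by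
        rw [lintegral_const_mul' _ _ h3, lintegral_add_right _ m2, lintegral_add_right _ m1,
          lintegral_stripDomain_diffQuot hm hq hlt hp hfm hfp]
        gcongr
        · exact lintegral_oscQuot_lower_le hm hq ha hp hfm hfmi
        · exact lintegral_oscQuot_upper_le hm hq ha hp hfp hfpi

theorem memLp_of_lintegral_rpow_ne_top {α : Type*} [MeasurableSpace α] {μ : Measure α}
    {F : Type*} [NormedAddCommGroup F] {p : ℝ} (hp : 0 < p) {g : α → F}
    (hg : AEStronglyMeasurable g μ) (h : ∫⁻ x, ‖g x‖ₑ ^ p ∂μ ≠ ⊤) :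
    MemLp g (ENNReal.ofReal p) μ := by
  refine ⟨hg, (eLpNorm_lt_top_iff_lintegral_rpow_enorm_lt_top (by simpa using hp)
    ENNReal.ofReal_ne_top).2 ?_⟩
  rw [ENNReal.toReal_ofReal hp.le]
  exact h.lt_top

/-- The constant in the energy estimate of the extension. -/
def extConst (n : ℕ) (a p : ℝ) : ℝ≥0 :=
  (extPointConst n).toNNReal ^ p * 3 ^ p * (1 + (oscEnergyConst n a p).toNNReal)

theorem extConst_pos (n : ℕ) (a p : ℝ) : 0 < extConst n a p := by
  have h := Real.toNNReal_pos.2 (extPointConst_pos n)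
  have h3 : (0 : ℝ≥0) < 3 := by norm_num
  exact mul_pos (mul_pos (NNReal.rpow_pos h) (NNReal.rpow_pos h3)) (by positivity)

/-- The extension of measurable boundary data has the right trace, and its energy is controlled. -/
theorem stripExt_spec_of_measurable {a p : ℝ} (ha : 0 < a) (ha1 : a < 1) (hp : 1 < p)
    {ηm ηp fm fp : Horiz n → ℝ} {Λm Λp : ℝ≥0} (hm : LipschitzWith Λm ηm)
    (hq : LipschitzWith Λp ηp) (hlt : ∀ x, ηm x < ηp x) (hfm : Measurable fm)
    (hfp : Measurable fp) (hfmp : MemLpLoc p fm) (hfpp : MemLpLoc p fp)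
    (hw : weightedDiff p ηm ηp fm fp ≠ ⊤)
    (hsm : screenedEnergy (1 - 1 / p) p (stripScreen a ηm ηp) fm ≠ ⊤)
    (hsp : screenedEnergy (1 - 1 / p) p (stripScreen a ηm ηp) fp ≠ ⊤) :
    MemLp (euclGradient (stripExt a ηm ηp (fm, fp))) (ENNReal.ofReal p)
      (volume.restrict (stripDomain ηm ηp)) ∧
    HasTrace p ηm ηp (stripExt a ηm ηp (fm, fp)) (euclGradient (stripExt a ηm ηp (fm, fp)))
      fm fp ∧
    gradEnergy p (stripDomain ηm ηp) (euclGradient (stripExt a ηm ηp (fm, fp))) ≤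
      extConst n a p * (1 + ((Λm : ℝ≥0∞) + Λp)) ^ p * (weightedDiff p ηm ηp fm fp +
        screenedEnergy (1 - 1 / p) p (stripScreen a ηm ηp) fm +
        screenedEnergy (1 - 1 / p) p (stripScreen a ηm ηp) fp) := by
  have hp0 : 0 < p := by linarith
  have hmc := hm.continuous
  have hqc := hq.continuous
  have hfmi := hfmp.locallyIntegrable hp
  have hfpi := hfpp.locallyIntegrable hp
  set Ω := stripDomain ηm ηp with hΩ
  have hΩo : IsOpen Ω := isOpen_stripDomain hmc hqc
  have hΩm := hΩo.measurableSet
  set u := stripExt a ηm ηp (fm, fp) with hu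
  set Q := stripMajorant a ηm ηp fm fp with hQ
  have hQm : Measurable Q := measurable_stripMajorant a hmc hqc hfm hfp
  have hQ0 : ∀ x ∈ Ω, 0 ≤ Q x := fun x hx => stripMajorant_nonneg ha hx
  have hQint := lintegral_stripMajorant_rpow_le ha hp hmc hqc hlt hfm hfp hfmi hfpi
  rw [← hΩ, ← hQ] at hQint
  have hQtop : ∫⁻ x in Ω, ENNReal.ofReal (Q x) ^ p ≠ ⊤ := by
    refine ne_top_of_le_ne_top ?_ hQint
    refine ENNReal.mul_ne_top (ENNReal.rpow_ne_top_of_nonneg hp0.le (by simp)) ?_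
    exact ENNReal.add_ne_top.2 ⟨ENNReal.add_ne_top.2 ⟨hw, ENNReal.mul_ne_top
      ENNReal.ofReal_ne_top hsm⟩, ENNReal.mul_ne_top ENNReal.ofReal_ne_top hsp⟩
  have hQenorm : ∫⁻ x in Ω, ‖Q x‖ₑ ^ p = ∫⁻ x in Ω, ENNReal.ofReal (Q x) ^ p := by
    refine setLIntegral_congr_fun hΩm fun x hx => ?_
    rw [Real.enorm_eq_ofReal (hQ0 x hx)]
  have hQLp : MemLp Q (ENNReal.ofReal p) (volume.restrict Ω) :=
    memLp_of_lintegral_rpow_ne_top hp0 hQm.aestronglyMeasurable (by rwa [hQenorm])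
  have hQK : ∀ K : Set (Horiz n × ℝ), IsCompact K → IntegrableOn Q (Ω ∩ K) := by
    intro K hK
    have hfin : IsFiniteMeasure ((volume : Measure (Horiz n × ℝ)).restrict (Ω ∩ K)) :=
      ⟨by
        rw [Measure.restrict_apply_univ]
        exact (measure_mono inter_subset_right).trans_lt hK.measure_lt_top⟩
    exact (hQLp.mono_measure (Measure.restrict_mono inter_subset_left le_rfl)).integrable
      (by simpa using hp.le)
  set G := euclGradient u with hG
  have hGm : StronglyMeasurable G := stronglyMeasurable_euclGradient u
  set C : ℝ := extPointConst n * (1 + (Λm + Λp : ℝ≥0)) with hC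
  have hGQ : ∀ᵐ x : Horiz n × ℝ, x ∈ Ω → ‖G x‖ ≤ C * Q x := by
    filter_upwards [ae_norm_fderiv_stripExt_le ha ha1 hm hq hfmi hfpi] with x hx hxΩ
    exact (norm_euclGradient_le u x).trans (hx hxΩ)
  have hGQ' : ∀ K : Set (Horiz n × ℝ), MeasurableSet K →
      ∀ᵐ x ∂(volume.restrict (Ω ∩ K)), ‖G x‖ ≤ C * Q x := by
    intro K hK
    filter_upwards [ae_restrict_of_ae hGQ, ae_restrict_mem (hΩm.inter hK)] with x h1 h2
    exact h1 h2.1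
  have hulip : ∀ x ∈ Ω, LipNear u x := fun x hx => lipNear_stripExt ha ha1 hm hq hfmi hfpi hx
  have hucont : ContinuousOn u Ω := fun x hx => (hulip x hx).continuousAt.continuousWithinAt
  have hum : AEStronglyMeasurable u (volume.restrict Ω) := hucont.aestronglyMeasurable hΩm
  have hqm : ∀ K : Set (Horiz n × ℝ), IsCompact K →
      IntegrableOn (fun x => (u x - fm x.1) / (x.2 - ηm x.1)) (Ω ∩ K) := by
    intro K hK
    refine ((hQK K hK).const_mul (extPointConst n)).mono' ?_ ?_
    · refine AEStronglyMeasurable.mono_measure ?_ (Measure.restrict_mono inter_subset_left le_rfl)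
      have h2 : Measurable fun x : Horiz n × ℝ => x.2 - ηm x.1 :=
        Continuous.measurable (by fun_prop)
      exact ((hum.aemeasurable.sub (hfm.comp measurable_fst).aemeasurable).div
        h2.aemeasurable).aestronglyMeasurable
    · filter_upwards [ae_restrict_mem (hΩm.inter hK.measurableSet)] with x hx
      exact abs_stripExt_sub_lower_le ha ha1 hfmi hfpi hx.1
  have hqp : ∀ K : Set (Horiz n × ℝ), IsCompact K →
      IntegrableOn (fun x => (u x - fp x.1) / (ηp x.1 - x.2)) (Ω ∩ K) := by
    intro K hK
    refine ((hQK K hK).const_mul (extPointConst n)).mono' ?_ ?_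
    · refine AEStronglyMeasurable.mono_measure ?_ (Measure.restrict_mono inter_subset_left le_rfl)
      have h2 : Measurable fun x : Horiz n × ℝ => ηp x.1 - x.2 :=
        Continuous.measurable (by fun_prop)
      exact ((hum.aemeasurable.sub (hfp.comp measurable_fst).aemeasurable).div
        h2.aemeasurable).aestronglyMeasurable
    · filter_upwards [ae_restrict_mem (hΩm.inter hK.measurableSet)] with x hx
      exact abs_stripExt_sub_upper_le ha ha1 hfmi hfpi hx.1
  have hGi : ∀ K : Set (Horiz n × ℝ), IsCompact K → IntegrableOn G (Ω ∩ K) := fun K hK =>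
    ((hQK K hK).const_mul C).mono' hGm.aestronglyMeasurable (hGQ' K hK.measurableSet)
  -- Up to the boundary, `u` is its boundary quotient times the bounded height, plus `fm`.
  have hui : ∀ K : Set (Horiz n × ℝ), IsCompact K → IntegrableOn u (Ω ∩ K) := by
    intro K hK
    have hcτ : Continuous fun x : Horiz n × ℝ => x.2 - ηm x.1 := by fun_prop
    obtain ⟨T, hT⟩ := (hK.image hcτ).isBounded.exists_norm_le
    have i1 : IntegrableOn (fun x => (u x - fm x.1) / (x.2 - ηm x.1) * (x.2 - ηm x.1))
        (Ω ∩ K) := by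
      refine Integrable.mul_bdd (c := T) (hqm K hK) hcτ.aestronglyMeasurable ?_
      filter_upwards [ae_restrict_mem (hΩm.inter hK.measurableSet)] with x hx
      exact hT _ ⟨x, hx.2, rfl⟩
    have i2 : IntegrableOn (fun x : Horiz n × ℝ => fm x.1) (Ω ∩ K) := by
      have h1 : IsCompact (Prod.fst '' K) := hK.image continuous_fst
      have h2 : IsCompact (Prod.snd '' K) := hK.image continuous_snd
      have hfin : IsFiniteMeasure ((volume : Measure ℝ).restrict (Prod.snd '' K)) :=
        ⟨by simpa using h2.measure_lt_top⟩
      have : Integrable (fun x : Horiz n × ℝ => fm x.1)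
          ((volume.restrict (Prod.fst '' K)).prod (volume.restrict (Prod.snd '' K))) :=
        (hfmi.integrableOn_isCompact h1).comp_fst _
      rw [Measure.prod_restrict, ← Measure.volume_eq_prod] at this
      exact IntegrableOn.mono_set (t := (Prod.fst '' K) ×ˢ (Prod.snd '' K)) this
        fun x hx => ⟨⟨x, hx.2, rfl⟩, ⟨x, hx.2, rfl⟩⟩
    refine (i1.add i2).congr_fun (fun x hx => ?_) (hΩm.inter hK.measurableSet)
    have h0 : x.2 - ηm x.1 ≠ 0 := (by linarith [hx.1.1] : (0 : ℝ) < x.2 - ηm x.1).ne'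
    simp only [Pi.add_apply]
    rw [div_mul_cancel₀ _ h0]; ring
  have hE : gradEnergy p Ω G ≤ extConst n a p * (1 + ((Λm : ℝ≥0∞) + Λp)) ^ p *
      (weightedDiff p ηm ηp fm fp +
        screenedEnergy (1 - 1 / p) p (stripScreen a ηm ηp) fm +
        screenedEnergy (1 - 1 / p) p (stripScreen a ηm ηp) fp) := by
    have hC0 : 0 ≤ C := mul_nonneg (extPointConst_pos n).le (by positivity)
    have hCe : ENNReal.ofReal C =
        ((extPointConst n).toNNReal : ℝ≥0∞) * (1 + ((Λm : ℝ≥0∞) + Λp)) := by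
      rw [hC, ENNReal.ofReal_mul (extPointConst_pos n).le]
      congr 1
      rw [← NNReal.coe_one, ← NNReal.coe_add, ENNReal.ofReal_coe_nnreal]
      push_cast; rfl
    have h1 : gradEnergy p Ω G ≤ ENNReal.ofReal C ^ p *
        ∫⁻ x in Ω, ENNReal.ofReal (Q x) ^ p := by
      rw [gradEnergy, ← lintegral_const_mul' _ _
        (ENNReal.rpow_ne_top_of_nonneg hp0.le ENNReal.ofReal_ne_top)]
      refine lintegral_mono_ae ?_
      filter_upwards [ae_restrict_of_ae hGQ, ae_restrict_mem hΩm] with x hx1 hx2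
      rw [← ENNReal.mul_rpow_of_nonneg _ _ hp0.le, ← ENNReal.ofReal_mul hC0]
      refine ENNReal.rpow_le_rpow ?_ hp0.le
      rw [← ofReal_norm]
      exact ENNReal.ofReal_le_ofReal (hx1 hx2)
    refine (h1.trans (mul_le_mul_right hQint _)).trans ?_
    set k : ℝ≥0∞ := ENNReal.ofReal (oscEnergyConst n a p) with hk
    have hbr : ∀ x y z : ℝ≥0∞, x + k * y + k * z ≤ (1 + k) * (x + y + z) := by
      intro x y z
      rw [mul_add, mul_add]
      gcongr
      · exact le_mul_of_one_le_left zero_le le_self_add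
      · exact le_add_self
      · exact le_add_self
    have hce : ((extConst n a p : ℝ≥0) : ℝ≥0∞) =
        ((extPointConst n).toNNReal : ℝ≥0∞) ^ p * 3 ^ p * (1 + k) := by
      rw [extConst, hk, ENNReal.coe_mul, ENNReal.coe_mul, ENNReal.coe_rpow_of_nonneg _ hp0.le,
        ENNReal.coe_rpow_of_nonneg _ hp0.le, ENNReal.coe_add]
      rfl
    rw [hce, hCe, ENNReal.mul_rpow_of_nonneg _ _ hp0.le]
    refine (mul_le_mul_right (mul_le_mul_right (hbr _ _ _) _) _).trans (le_of_eq ?_)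
    ring
  have hGLp : MemLp G (ENNReal.ofReal p) (volume.restrict Ω) := by
    refine memLp_of_lintegral_rpow_ne_top hp0 hGm.aestronglyMeasurable ?_
    refine ne_top_of_le_ne_top ?_ hE
    refine ENNReal.mul_ne_top (ENNReal.mul_ne_top ENNReal.coe_ne_top
      (ENNReal.rpow_ne_top_of_nonneg hp0.le ?_)) ?_
    · finiteness
    · exact ENNReal.add_ne_top.2 ⟨ENNReal.add_ne_top.2 ⟨hw, hsm⟩, hsp⟩
  exact ⟨hGLp, hasTrace_of_lipNear hp hm hq hlt hfmp hfpp hulip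
    (fun x _ v => inner_euclGradient u x v) hui hGi hqm hqp, hE⟩

/-! ### Independence of the representatives -/

theorem MemLpLoc.congr_ae {p : ℝ} {f g : Horiz n → ℝ} (h : f =ᵐ[volume] g) (hf : MemLpLoc p f) :
    MemLpLoc p g := fun K hK => (memLp_congr_ae (ae_restrict_of_ae h)).1 (hf K hK)

theorem weightedDiff_congr_ae {p : ℝ} {ηm ηp fm fp gm gp : Horiz n → ℝ}
    (hm : fm =ᵐ[volume] gm) (hp : fp =ᵐ[volume] gp) :
    weightedDiff p ηm ηp fm fp = weightedDiff p ηm ηp gm gp := by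
  refine lintegral_congr_ae ?_
  filter_upwards [hm, hp] with x h1 h2
  rw [h1, h2]

/-- For each fixed `x` the translation `h ↦ x + h` preserves null sets. -/
theorem screenedEnergy_congr_ae {s p : ℝ} {σ f g : Horiz n → ℝ} (h : f =ᵐ[volume] g) :
    screenedEnergy s p σ f = screenedEnergy s p σ g := by
  refine lintegral_congr_ae ?_
  filter_upwards [h] with x hx
  refine lintegral_congr_ae (ae_restrict_of_ae ?_)
  filter_upwards [(measurePreserving_add_left volume x).quasiMeasurePreserving.ae h] with y hy
  rw [hx, hy]

theorem HasTrace.congr_ae {p : ℝ} {ηm ηp : Horiz n → ℝ} {u : Horiz n × ℝ → ℝ}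
    {G : Horiz n × ℝ → EVec n} {fm fp gm gp : Horiz n → ℝ} (hm : fm =ᵐ[volume] gm)
    (hp : fp =ᵐ[volume] gp) (h : HasTrace p ηm ηp u G fm fp) : HasTrace p ηm ηp u G gm gp := by
  obtain ⟨h1, h2, h3, h4, h5⟩ := h
  refine ⟨h1.congr_ae hm, h2.congr_ae hp, h3, h4, fun ψ hψ hc v => ?_⟩
  rw [h5 ψ hψ hc v]
  congr 1
  · congr 1
    refine integral_congr_ae ?_
    filter_upwards [hp] with x hx
    rw [hx]
  · refine integral_congr_ae ?_
    filter_upwards [hm] with x hx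
    rw [hx]

theorem lipschitzWith_of_lipSeminorm_ne_top {η : Horiz n → ℝ} (h : lipSeminorm η ≠ ⊤) :
    LipschitzWith (lipSeminorm η).toNNReal η := by
  intro x y
  rw [ENNReal.coe_toNNReal h]
  rcases eq_or_ne x y with rfl | hxy
  · simp
  · have h0 : edist x y ≠ 0 := by simpa [edist_eq_zero] using hxy
    rw [← ENNReal.div_le_iff h0 (edist_ne_top x y)]
    exact le_iSup₂ (f := fun x y => edist (η x) (η y) / edist x y) x y

theorem screenedSeminorm_rpow {s p : ℝ} (hp : 1 < p) (σ f : Horiz n → ℝ) :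
    screenedSeminorm s p σ f ^ p = screenedEnergy s p σ f := by
  rw [screenedSeminorm, ← ENNReal.rpow_mul, one_div_mul_cancel (by linarith), ENNReal.rpow_one]

/-- The oscillation quotient uses point values of the data, so the estimates are carried out for
measurable representatives. The averages do not see null sets, so the extension is literally
unchanged, and the trace and energies transfer back. -/
theorem stripExt_spec {a p : ℝ} (ha : 0 < a) (ha1 : a < 1) (hp : 1 < p)
    {ηm ηp : Horiz n → ℝ} (hm : lipSeminorm ηm ≠ ⊤) (hq : lipSeminorm ηp ≠ ⊤)
    (hlt : ∀ x, ηm x < ηp x) {f : (Horiz n → ℝ) × (Horiz n → ℝ)}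
    (hf : f ∈ boundaryData p a ηm ηp hp hm hq) :
    ∃ G : Horiz n × ℝ → EVec n,
      MemLp G (ENNReal.ofReal p) (volume.restrict (stripDomain ηm ηp)) ∧
      HasTrace p ηm ηp (stripExt a ηm ηp f) G f.1 f.2 ∧
      gradEnergy p (stripDomain ηm ηp) G ≤
        extConst n a p * (1 + (lipSeminorm ηm + lipSeminorm ηp)) ^ p *
          (weightedDiff p ηm ηp f.1 f.2 +
            screenedEnergy (1 - 1 / p) p (stripScreen a ηm ηp) f.1 +
            screenedEnergy (1 - 1 / p) p (stripScreen a ηm ηp) f.2) := by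
  obtain ⟨h1, h2, h3, h4, h5⟩ := hf
  rw [screenedSeminorm_ne_top_iff hp] at h4 h5
  have m1 := h1.aemeasurable hp
  have m2 := h2.aemeasurable hp
  have e1 := m1.ae_eq_mk
  have e2 := m2.ae_eq_mk
  have key := stripExt_spec_of_measurable ha ha1 hp (lipschitzWith_of_lipSeminorm_ne_top hm)
    (lipschitzWith_of_lipSeminorm_ne_top hq) hlt m1.measurable_mk m2.measurable_mk
    (h1.congr_ae e1) (h2.congr_ae e2) (by rwa [← weightedDiff_congr_ae e1 e2])
    (by rwa [← screenedEnergy_congr_ae e1]) (by rwa [← screenedEnergy_congr_ae e2])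
  rw [← weightedDiff_congr_ae e1 e2, ← screenedEnergy_congr_ae e1, ← screenedEnergy_congr_ae e2,
    ENNReal.coe_toNNReal hm, ENNReal.coe_toNNReal hq,
    ← stripExt_congr_ae (f := f) e1 e2] at key
  exact ⟨_, key.1, key.2.1.congr_ae e1.symm e2.symm, key.2.2⟩

end Assembly

end

/-! ### The extension theorem. -/

theorem theorem4p3 (n : ℕ) (hn : 1 ≤ n) (a p : ℝ) (ha0 : 0 < a) (ha1 : a < 1) (hp : 1 < p) :
    ∃ c : ℝ≥0, 0 < c ∧
      ∀ (ηm ηp : Horiz n → ℝ) (hm : lipSeminorm ηm ≠ ⊤) (hq : lipSeminorm ηp ≠ ⊤),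
        (∀ x, ηm x < ηp x) →
        ∃ T : boundaryData p a ηm ηp hp hm hq →ₗ[ℝ] homSobolev p (stripDomain ηm ηp),
          ∀ f : boundaryData p a ηm ηp hp hm hq,
            ∃ G : Horiz n × ℝ → EVec n,
              IsWeakGradient (stripDomain ηm ηp) (T f : Horiz n × ℝ → ℝ) G ∧
              HasTrace p ηm ηp (T f : Horiz n × ℝ → ℝ) G f.1.1 f.1.2 ∧
              gradEnergy p (stripDomain ηm ηp) G ≤
                c * (1 + (lipSeminorm ηm + lipSeminorm ηp)) ^ p *
                    weightedDiff p ηm ηp f.1.1 f.1.2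
                  + c * (1 + (lipSeminorm ηm + lipSeminorm ηp)) ^ p *
                    screenedSeminorm (1 - 1 / p) p (stripScreen a ηm ηp) f.1.1 ^ p
                  + c * (1 + (lipSeminorm ηm + lipSeminorm ηp)) ^ p *
                    screenedSeminorm (1 - 1 / p) p (stripScreen a ηm ηp) f.1.2 ^ p := by
  refine ⟨extConst n a p, extConst_pos n a p, fun ηm ηp hm hq hlt => ?_⟩
  have cm := continuous_of_lipSeminorm_ne_top hm
  have cq := continuous_of_lipSeminorm_ne_top hq
  -- The extension is an explicit formula, so linearity is that of the averages; membership in the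
  -- Sobolev space follows since the trace formula contains the weak gradient formula.
  refine ⟨{
    toFun := fun f => ⟨stripExt a ηm ηp f.1, by
      obtain ⟨G, h1, h2, -⟩ := stripExt_spec ha0 ha1 hp hm hq hlt f.2
      exact ⟨G, h2.isWeakGradient cm cq, h1⟩⟩
    map_add' := fun f g => Subtype.ext (stripExt_add (f.2.1.locallyIntegrable hp)
      (f.2.2.1.locallyIntegrable hp) (g.2.1.locallyIntegrable hp)
      (g.2.2.1.locallyIntegrable hp))
    map_smul' := fun c f => Subtype.ext (stripExt_smul c f.1) }, fun f => ?_⟩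
  obtain ⟨G, -, h2, h3⟩ := stripExt_spec ha0 ha1 hp hm hq hlt f.2
  refine ⟨G, h2.isWeakGradient cm cq, h2, h3.trans (le_of_eq ?_)⟩
  rw [screenedSeminorm_rpow hp, screenedSeminorm_rpow hp, mul_add, mul_add]
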